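/- Let $\mathbb{U}$ be the open unit disc in $\mathbb{C}$ and let $H^2$ be the Hardy space of $\mathbb{U}$, i.e. the Hilbert space of holomorphic functions $f(z)=\sum_{n\ge 0} a_n z^n$ on $\mathbb{U}$ with $\|f\|^2=\sum_{n\ge 0}|a_n|^2<\infty$. For a bounded analytic function $\varphi$ on $\mathbb{U}$ let $T_\varphi:H^2\to H^2$, $T_\varphi f=\varphi f$, be the analytic Toeplitz operator with symbol $\varphi$. Let $\varphi$ and $\psi$ be bounded analytic functions on $\mathbb{U}$, let $\varphi$ be univalent (injective on $\mathbb{U}$), and let $X$ be a bounded linear operator on $H^2$ that intertwines $T_\varphi$ and $T_\psi$, that is, $X T_\varphi=T_\psi X$ and $X\neq 0$. Then $X$ is a weighted composition operator: there are a holomorphic map $\omega:\mathbb{U}\to\mathbb{U}$ and a function $h\in H^2$ such that $X=C_{\omega,h}$, i.e. $Xf=h\cdot(f\circ\omega)$ for every $f\in H^2$. -/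

import Mathlib

/-- The Hardy space `H²` of the open unit disc `ball 0 1`, an element being given by the
square-summable sequence of its Taylor coefficients at the origin, with the inner product and norm
of `ℓ²`. The function on the disc is `hardyEval f`. -/
abbrev HardySpace : Type := lp (fun _ : ℕ => ℂ) 2

/-- The value at `z`, for `‖z‖ < 1`, of the function `∑ aₙ zⁿ` that an element of `H²` is. -/
noncomputable def hardyEval (f : HardySpace) (z : ℂ) : ℂ := ∑' n : ℕ, f n * z ^ n

/-- Bounded analytic functions on the open unit disc. Values outside the disc are irrelevant. -/
structure IsBoundedAnalytic (φ : ℂ → ℂ) : Prop where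
  differentiableOn : DifferentiableOn ℂ φ (Metric.ball 0 1)
  bounded : ∃ C : ℝ, ∀ z ∈ Metric.ball (0 : ℂ) 1, ‖φ z‖ ≤ C

theorem summable_norm_mul_pow {a : ℕ → ℂ} {C r : ℝ} (ha : ∀ n, ‖a n‖ ≤ C) (h0 : 0 ≤ r)
    (h1 : r < 1) : Summable fun n => ‖a n‖ * r ^ n :=
  Summable.of_nonneg_of_le (fun n => by positivity)
    (fun n => mul_le_mul_of_nonneg_right (ha n) (by positivity))
    ((summable_geometric_of_lt_one h0 h1).mul_left C)

theorem hardy_norm_coeff_le (f : HardySpace) (n : ℕ) : ‖f n‖ ≤ ‖f‖ :=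
  lp.norm_apply_le_norm (by norm_num) f n

theorem hasSum_hardyEval (f : HardySpace) {z : ℂ} (hz : ‖z‖ < 1) :
    HasSum (fun n : ℕ => f n * z ^ n) (hardyEval f z) := by
  have h := summable_norm_mul_pow (hardy_norm_coeff_le f) (norm_nonneg z) hz
  exact (Summable.of_norm (by simpa using h)).hasSum

theorem differentiableOn_hardyEval (f : HardySpace) :
    DifferentiableOn ℂ (hardyEval f) (Metric.ball 0 1) := by
  intro z hz
  rw [mem_ball_zero_iff] at hz
  obtain ⟨r, hzr, hr⟩ := exists_between hz
  have hr0 : 0 ≤ r := (norm_nonneg z).trans hzr.le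
  have h : DifferentiableOn ℂ (hardyEval f) (Metric.ball 0 r) := by
    refine Complex.differentiableOn_tsum_of_summable_norm
      (summable_norm_mul_pow (hardy_norm_coeff_le f) hr0 hr) (fun n => by fun_prop)
      Metric.isOpen_ball ?_
    intro n w hw
    rw [mem_ball_zero_iff] at hw
    rw [norm_mul, norm_pow]
    gcongr
  exact (h.differentiableAt (Metric.isOpen_ball.mem_nhds (by simpa using hzr))).differentiableWithinAt

theorem integral_cexp_int (k : ℤ) :
    ∫ θ in (0 : ℝ)..2 * Real.pi, Complex.exp ((k * Complex.I) * θ) =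
      if k = 0 then 2 * (Real.pi : ℂ) else 0 := by
  split_ifs with hk
  · simp [hk]
  · have hc : (k : ℂ) * Complex.I ≠ 0 := by simp [hk]
    rw [integral_exp_mul_complex hc]
    have : (k : ℂ) * Complex.I * ((2 * Real.pi : ℝ) : ℂ) = k * (2 * Real.pi * Complex.I) := by
      push_cast; ring
    rw [this, Complex.exp_int_mul_two_pi_mul_I]
    simp

/-- Parseval's identity for power series on circles. -/
theorem hasSum_sq_circleAverage {F : ℂ → ℂ} {a : ℕ → ℂ} {r : ℝ} (hr : 0 ≤ r)
    (hs : Summable fun n => ‖a n‖ * r ^ n)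
    (hF : ∀ z : ℂ, ‖z‖ = r → HasSum (fun n => a n * z ^ n) (F z)) :
    HasSum (fun n => ‖a n‖ ^ 2 * r ^ (2 * n))
      (Real.circleAverage (fun z => ‖F z‖ ^ 2) 0 r) := by
  have hnorm : ∀ θ : ℝ, ‖circleMap 0 r θ‖ = r := by
    intro θ; simp [norm_circleMap_zero, abs_of_nonneg hr]
  set G : ℕ × ℕ → ℝ → ℂ := fun p θ =>
    (a p.1 * circleMap 0 r θ ^ p.1) * (starRingEnd ℂ) (a p.2 * circleMap 0 r θ ^ p.2) with hG
  have hsum2 : Summable fun p : ℕ × ℕ => (‖a p.1‖ * r ^ p.1) * (‖a p.2‖ * r ^ p.2) :=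
    hs.mul_of_nonneg hs (fun n => by positivity) (fun n => by positivity)
  have hGnorm : ∀ p θ, ‖G p θ‖ = (‖a p.1‖ * r ^ p.1) * (‖a p.2‖ * r ^ p.2) := by
    intro p θ
    simp only [hG, norm_mul, RCLike.norm_conj, norm_pow, hnorm]
  have hlim : ∀ θ, HasSum (fun p => G p θ) (((‖F (circleMap 0 r θ)‖ ^ 2 : ℝ)) : ℂ) := by
    intro θ
    have h1 := hF _ (hnorm θ)
    have h2 : HasSum (fun n => (starRingEnd ℂ) (a n * circleMap 0 r θ ^ n))
        ((starRingEnd ℂ) (F (circleMap 0 r θ))) := Complex.hasSum_conj'.2 h1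
    have h3 := h1.mul h2 (Summable.of_norm (by
      refine hsum2.congr fun p => ?_
      exact (hGnorm p θ).symm))
    rw [Complex.mul_conj, Complex.normSq_eq_norm_sq] at h3
    exact h3
  have hint : ∀ p : ℕ × ℕ, ∫ θ in (0 : ℝ)..2 * Real.pi, G p θ =
      if p.1 = p.2 then 2 * (Real.pi : ℂ) * ((‖a p.1‖ ^ 2 * r ^ (2 * p.1) : ℝ) : ℂ) else 0 := by
    intro p
    have hGe : ∀ θ : ℝ, G p θ = (a p.1 * (starRingEnd ℂ) (a p.2) * (r : ℂ) ^ (p.1 + p.2)) *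
        Complex.exp (((((p.1 : ℤ) - p.2 : ℤ) : ℂ) * Complex.I) * θ) := by
      intro θ
      have e1 : Complex.exp (((((p.1 : ℤ) - p.2 : ℤ) : ℂ) * Complex.I) * θ) =
          Complex.exp (θ * Complex.I) ^ p.1 * Complex.exp (-(θ * Complex.I)) ^ p.2 := by
        rw [← Complex.exp_nat_mul, ← Complex.exp_nat_mul, ← Complex.exp_add]
        congr 1
        push_cast
        ring
      have e2 : (starRingEnd ℂ) (Complex.exp (θ * Complex.I)) =
          Complex.exp (-(θ * Complex.I)) := by
        rw [← Complex.exp_conj]; simp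
      rw [e1]
      simp only [hG, circleMap_zero, map_mul, map_pow, e2, Complex.conj_ofReal]
      ring
    simp_rw [hGe]
    rw [intervalIntegral.integral_const_mul, integral_cexp_int]
    by_cases h : p.1 = p.2
    · rw [if_pos (by omega), if_pos h, ← h, Complex.mul_conj, Complex.normSq_eq_norm_sq]
      push_cast
      ring
    · rw [if_neg (by omega), if_neg h, mul_zero]
  have key : HasSum (fun p : ℕ × ℕ => ∫ θ in (0 : ℝ)..2 * Real.pi, G p θ)
      (∫ θ in (0 : ℝ)..2 * Real.pi, (((‖F (circleMap 0 r θ)‖ ^ 2 : ℝ)) : ℂ)) := by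
    refine intervalIntegral.hasSum_integral_of_dominated_convergence
      (fun p _ => (‖a p.1‖ * r ^ p.1) * (‖a p.2‖ * r ^ p.2)) ?_ ?_ ?_ ?_ ?_
    · intro p
      have : Continuous (G p) := by
        simp only [hG]
        fun_prop
      exact this.aestronglyMeasurable
    · exact fun p => Filter.Eventually.of_forall fun θ _ => (hGnorm p θ).le
    · exact Filter.Eventually.of_forall fun θ _ => hsum2
    · exact intervalIntegrable_const
    · exact Filter.Eventually.of_forall fun θ _ => hlim θ
  simp_rw [hint] at key
  have hinj : Function.Injective (fun n : ℕ => (n, n)) := fun m n h => (Prod.ext_iff.1 h).1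
  rw [← hinj.hasSum_iff] at key
  · have key2 : HasSum (fun n : ℕ => 2 * (Real.pi : ℂ) * ((‖a n‖ ^ 2 * r ^ (2 * n) : ℝ) : ℂ))
        (∫ θ in (0 : ℝ)..2 * Real.pi, (((‖F (circleMap 0 r θ)‖ ^ 2 : ℝ)) : ℂ)) := by
      refine key.congr_fun ?_
      intro n; simp
    rw [intervalIntegral.integral_ofReal] at key2
    have key3 : HasSum (fun n : ℕ => 2 * Real.pi * (‖a n‖ ^ 2 * r ^ (2 * n)))
        (∫ θ in (0 : ℝ)..2 * Real.pi, ‖F (circleMap 0 r θ)‖ ^ 2) := by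
      rw [← Complex.hasSum_ofReal]
      refine key2.congr_fun ?_
      intro n; push_cast; ring
    have key4 := key3.mul_left (2 * Real.pi)⁻¹
    have hpi : (2 * Real.pi) ≠ 0 := by positivity
    rw [Real.circleAverage_def, smul_eq_mul]
    refine key4.congr_fun ?_
    intro n; field_simp
  · intro p hp
    rw [if_neg]
    intro h
    exact hp ⟨p.1, by ext <;> simp [h]⟩

/-- The integral means of an element of `H²` are bounded by the square of its norm. -/
theorem circleAverage_hardyEval_le (f : HardySpace) {r : ℝ} (h0 : 0 ≤ r) (h1 : r < 1) :
    Real.circleAverage (fun z => ‖hardyEval f z‖ ^ 2) 0 r ≤ ‖f‖ ^ 2 := by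
  have h := hasSum_sq_circleAverage h0 (summable_norm_mul_pow (hardy_norm_coeff_le f) h0 h1)
    (fun z hz => hasSum_hardyEval f (hz ▸ h1))
  have h2 : HasSum (fun n => ‖f n‖ ^ 2) (‖f‖ ^ 2) := by
    simpa using lp.hasSum_norm (p := 2) (by norm_num) f
  refine hasSum_le (fun n => ?_) h h2
  exact mul_le_of_le_one_right (by positivity) (pow_le_one₀ h0 h1.le)

/-- A holomorphic function on the disc with bounded integral means belongs to `H²`. -/
theorem exists_hardyEval_of_bound {F : ℂ → ℂ} (hF : DifferentiableOn ℂ F (Metric.ball 0 1))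
    {M : ℝ} (hM0 : 0 ≤ M)
    (hM : ∀ r : ℝ, 0 ≤ r → r < 1 → Real.circleAverage (fun z => ‖F z‖ ^ 2) 0 r ≤ M ^ 2) :
    ∃ f : HardySpace, ‖f‖ ≤ M ∧ ∀ z ∈ Metric.ball (0 : ℂ) 1, hardyEval f z = F z := by
  set a : ℕ → ℂ := fun n => (n.factorial : ℂ)⁻¹ * iteratedDeriv n F 0 with ha
  have hsum : ∀ z : ℂ, ‖z‖ < 1 → HasSum (fun n => a n * z ^ n) (F z) := by
    intro z hz
    have h := Complex.hasSum_taylorSeries_on_ball hF (by simpa using hz)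
    refine h.congr_fun fun n => ?_
    simp only [ha, smul_eq_mul, sub_zero]
    ring
  have habs : ∀ r : ℝ, 0 ≤ r → r < 1 → Summable fun n => ‖a n‖ * r ^ n := by
    intro r h0 h1
    have h := (hsum (r : ℂ) (by simpa [abs_of_nonneg h0] using h1)).summable.norm
    simpa [abs_of_nonneg h0] using h
  have hfin : ∀ s : Finset ℕ, ∑ n ∈ s, ‖a n‖ ^ 2 ≤ M ^ 2 := by
    intro s
    have hr : ∀ r ∈ Set.Ico (0 : ℝ) 1, ∑ n ∈ s, ‖a n‖ ^ 2 * r ^ (2 * n) ≤ M ^ 2 := by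
      intro r hr
      have h := hasSum_sq_circleAverage hr.1 (habs r hr.1 hr.2)
        (fun z hz => hsum z (hz ▸ hr.2))
      exact (sum_le_hasSum s (fun n _ => by have := hr.1; positivity) h).trans (hM r hr.1 hr.2)
    have hcont : Continuous fun r : ℝ => ∑ n ∈ s, ‖a n‖ ^ 2 * r ^ (2 * n) := by fun_prop
    have hmem : (1 : ℝ) ∈ closure (Set.Ico (0 : ℝ) 1) := by
      rw [closure_Ico (by norm_num)]; simp
    have := closure_minimal (t := {r : ℝ | ∑ n ∈ s, ‖a n‖ ^ 2 * r ^ (2 * n) ≤ M ^ 2}) hr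
      (isClosed_le hcont continuous_const) hmem
    simpa using this
  have hmem : Memℓp a 2 := memℓp_gen' (C := M ^ 2) (by simpa using hfin)
  refine ⟨⟨a, hmem⟩, ?_, ?_⟩
  · exact lp.norm_le_of_forall_sum_le (by norm_num) hM0 (by simpa using hfin)
  · intro z hz
    exact (hsum z (by simpa using hz)).tsum_eq

/-- `H²` consists exactly of the holomorphic functions on the disc whose integral means
`(1/2π) ∫ |F(r e^{iθ})|² dθ`, `0 ≤ r < 1`, are bounded. -/
theorem exists_hardyEval_eq_iff (F : ℂ → ℂ) :
    (∃ f : HardySpace, ∀ z ∈ Metric.ball (0 : ℂ) 1, hardyEval f z = F z) ↔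
      DifferentiableOn ℂ F (Metric.ball 0 1) ∧
        ∃ C : ℝ, ∀ r : ℝ, 0 ≤ r → r < 1 →
          Real.circleAverage (fun z => ‖F z‖ ^ 2) 0 r ≤ C := by
  constructor
  · rintro ⟨f, hf⟩
    refine ⟨(differentiableOn_hardyEval f).congr fun z hz => (hf z hz).symm, ‖f‖ ^ 2, ?_⟩
    intro r h0 h1
    refine le_of_eq_of_le (Real.circleAverage_congr_sphere ?_) (circleAverage_hardyEval_le f h0 h1)
    intro z hz
    rw [mem_sphere_zero_iff_norm, abs_of_nonneg h0] at hz
    simp only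
    rw [hf z (by simpa [hz] using h1)]
  · rintro ⟨hF, C, hC⟩
    obtain ⟨f, -, hf⟩ := exists_hardyEval_of_bound hF (Real.sqrt_nonneg (max C 0)) (by
      intro r h0 h1
      rw [Real.sq_sqrt (le_max_right _ _)]
      exact (hC r h0 h1).trans (le_max_left _ _))
    exact ⟨f, hf⟩

/-- An element of `H²` is determined by the function it defines on the disc. -/
theorem hardyEval_injOn {f g : HardySpace}
    (h : ∀ z ∈ Metric.ball (0 : ℂ) 1, hardyEval f z = hardyEval g z) : f = g := by
  have hd : ∀ z : ℂ, ‖z‖ = 1 / 2 → HasSum (fun n => (f - g) n * z ^ n) 0 := by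
    intro z hz
    have hz1 : ‖z‖ < 1 := by rw [hz]; norm_num
    have h1 := (hasSum_hardyEval f hz1).sub (hasSum_hardyEval g hz1)
    rw [h z (by simpa using hz1), sub_self] at h1
    refine h1.congr_fun fun n => ?_
    simp [sub_mul]
  have hP := hasSum_sq_circleAverage (F := fun _ => 0) (a := fun n => (f - g) n)
    (r := 1 / 2) (by norm_num)
    (summable_norm_mul_pow (hardy_norm_coeff_le (f - g)) (by norm_num) (by norm_num)) hd
  have h0 : Real.circleAverage (fun _ : ℂ => ‖(0 : ℂ)‖ ^ 2) 0 (1 / 2) = 0 := by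
    rw [Real.circleAverage_const]; simp
  rw [h0, hasSum_zero_iff_of_nonneg (fun n => by positivity)] at hP
  apply lp.ext
  funext n
  have := congrFun hP n
  have h2 : (f - g) n = 0 := by simpa using this
  simpa [sub_eq_zero] using h2

/-- Multiplication by a function bounded by `C` maps `H²` to itself, with norm at most `C`. -/
theorem exists_hardy_mul {φ : ℂ → ℂ} (hφ : DifferentiableOn ℂ φ (Metric.ball 0 1)) {C : ℝ}
    (hC : ∀ z ∈ Metric.ball (0 : ℂ) 1, ‖φ z‖ ≤ C) (f : HardySpace) :
    ∃ g : HardySpace, ‖g‖ ≤ C * ‖f‖ ∧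
      ∀ z ∈ Metric.ball (0 : ℂ) 1, hardyEval g z = φ z * hardyEval f z := by
  have hC0 : 0 ≤ C := (norm_nonneg _).trans (hC 0 (by simp))
  refine exists_hardyEval_of_bound (hφ.mul (differentiableOn_hardyEval f)) (by positivity) ?_
  intro r h0 h1
  have hsub : Metric.sphere (0 : ℂ) |r| ⊆ Metric.ball 0 1 := by
    intro z hz
    rw [mem_sphere_zero_iff_norm, abs_of_nonneg h0] at hz
    simpa [hz] using h1
  have hci : ∀ F : ℂ → ℂ, DifferentiableOn ℂ F (Metric.ball 0 1) →
      CircleIntegrable (fun z => ‖F z‖ ^ 2) 0 r := fun F hF =>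
    ContinuousOn.circleIntegrable' ((hF.continuousOn.mono hsub).norm.pow 2)
  have hf := differentiableOn_hardyEval f
  calc Real.circleAverage (fun z => ‖φ z * hardyEval f z‖ ^ 2) 0 r
      ≤ Real.circleAverage (fun z => C ^ 2 • ‖hardyEval f z‖ ^ 2) 0 r := by
        refine Real.circleAverage_mono (hci _ (hφ.mul hf)) ((hci _ hf).const_smul (a := C ^ 2)) ?_
        intro z hz
        rw [norm_mul, mul_pow, smul_eq_mul]
        have := hC z (hsub hz)
        gcongr
    _ = C ^ 2 * Real.circleAverage (fun z => ‖hardyEval f z‖ ^ 2) 0 r := by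
        rw [Real.circleAverage_fun_smul, smul_eq_mul]
    _ ≤ C ^ 2 * ‖f‖ ^ 2 := by
        gcongr
        exact circleAverage_hardyEval_le f h0 h1
    _ = (C * ‖f‖) ^ 2 := by ring

theorem IsBoundedAnalytic.exists_mul {φ : ℂ → ℂ} (hφ : IsBoundedAnalytic φ) (f : HardySpace) :
    ∃ g : HardySpace,
      ∀ z ∈ Metric.ball (0 : ℂ) 1, hardyEval g z = φ z * hardyEval f z := by
  obtain ⟨C, hC⟩ := hφ.bounded
  obtain ⟨g, -, hg⟩ := exists_hardy_mul hφ.differentiableOn hC f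
  exact ⟨g, hg⟩

theorem hardyEval_add (f g : HardySpace) {z : ℂ} (hz : z ∈ Metric.ball (0 : ℂ) 1) :
    hardyEval (f + g) z = hardyEval f z + hardyEval g z := by
  rw [mem_ball_zero_iff] at hz
  refine HasSum.tsum_eq (((hasSum_hardyEval f hz).add (hasSum_hardyEval g hz)).congr_fun ?_)
  intro n
  simp [add_mul]

theorem hardyEval_smul (c : ℂ) (f : HardySpace) {z : ℂ} (hz : z ∈ Metric.ball (0 : ℂ) 1) :
    hardyEval (c • f) z = c * hardyEval f z := by
  rw [mem_ball_zero_iff] at hz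
  refine HasSum.tsum_eq (((hasSum_hardyEval f hz).mul_left c).congr_fun ?_)
  intro n
  simp [mul_assoc]

/-- The analytic Toeplitz operator `T_φ f = φ f` on `H²`, for `φ` bounded and analytic. -/
noncomputable def toeplitz (φ : ℂ → ℂ) (hφ : IsBoundedAnalytic φ) : HardySpace →L[ℂ] HardySpace :=
  LinearMap.mkContinuousOfExistsBound
    { toFun := fun f => (hφ.exists_mul f).choose
      map_add' := fun f g => hardyEval_injOn fun z hz => by
        rw [hardyEval_add _ _ hz, (hφ.exists_mul (f + g)).choose_spec z hz,
          (hφ.exists_mul f).choose_spec z hz, (hφ.exists_mul g).choose_spec z hz,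
          hardyEval_add _ _ hz, mul_add]
      map_smul' := fun c f => hardyEval_injOn fun z hz => by
        rw [RingHom.id_apply, hardyEval_smul _ _ hz, (hφ.exists_mul (c • f)).choose_spec z hz,
          (hφ.exists_mul f).choose_spec z hz, hardyEval_smul _ _ hz, mul_left_comm] }
    (by
      obtain ⟨C, hC⟩ := hφ.bounded
      refine ⟨C, fun f => ?_⟩
      obtain ⟨g, hg, hg'⟩ := exists_hardy_mul hφ.differentiableOn hC f
      have : (hφ.exists_mul f).choose = g := hardyEval_injOn fun z hz => by
        rw [(hφ.exists_mul f).choose_spec z hz, hg' z hz]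
      change ‖(hφ.exists_mul f).choose‖ ≤ C * ‖f‖
      rw [this]
      exact hg)

theorem hardyEval_toeplitz {φ : ℂ → ℂ} (hφ : IsBoundedAnalytic φ) (f : HardySpace) {z : ℂ}
    (hz : z ∈ Metric.ball (0 : ℂ) 1) :
    hardyEval (toeplitz φ hφ f) z = φ z * hardyEval f z :=
  (hφ.exists_mul f).choose_spec z hz

/-- `X` intertwines `A` and `B`: `X A = B X` and `X ≠ 0`. -/
def Intertwines (X A B : HardySpace →L[ℂ] HardySpace) : Prop :=
  X ∘L A = B ∘L X ∧ X ≠ 0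

/-- `X` is the weighted composition operator `C_{ω,h}`: `ω` is a holomorphic self-map of the disc
and `X f = h · (f ∘ ω)` for all `f` in `H²`. -/
def IsWeightedCompositionOperator (X : HardySpace →L[ℂ] HardySpace) (ω : ℂ → ℂ)
    (h : HardySpace) : Prop :=
  DifferentiableOn ℂ ω (Metric.ball 0 1) ∧
    Set.MapsTo ω (Metric.ball 0 1) (Metric.ball 0 1) ∧
    ∀ f : HardySpace, ∀ z ∈ Metric.ball (0 : ℂ) 1,
      hardyEval (X f) z = hardyEval h z * hardyEval f (ω z)

/-!
Write `U` for the unit disc. For `z ∈ U` the functional `L f = (X f)(z)` satisfies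
`L (φ f) = ψ(z) L f`, so it annihilates `(φ - c) H²` with `c = ψ(z)`. The core of the proof is that
for univalent `φ` this space is as large as it can be: dense in `H²` if `c ∉ φ(U)`
(`eq_zero_of_apply_toeplitz_eq_mul`), and dense in the functions vanishing at `a` if `c = φ(a)`
(`apply_eq_mul_hardyEval_of_apply_toeplitz_eq_mul`). Hence `(X f)(z) = h(z) f(τ(z))` with `h = X 1`
for some map `τ : U → U`. Taking for `f` the identity function shows that `τ` is a quotient of two
holomorphic functions off the zeros of `h`; it is bounded by `1`, so it extends to a holomorphic
`ω : U → U` by Riemann's removability theorem and the maximum principle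
(`exists_mapsTo_ball_eq_of_mul_eq`).

For the density, write `φ - c = G B` with `G` zero-free and `B = 1` or `B = z - a`. It suffices that
`1 / E ∈ H²` for some `N`-th root `E` of `G`: then multiplication by the bounded function `E` has
dense range, hence so has its `N`-th power, multiplication by `G`. That univalence forces
`G ^ (-1 / N) ∈ H²` for large `N` (`exists_hardyEval_rpow_neg`) replaces inner-outer factorisation:

* A logarithm of a zero-free univalent function takes no two values that differ by `2πi`, so by
  Bloch's theorem its derivative is `O(1 / R)` at the centre of a disc of radius `R`
  (`norm_logDeriv_le_of_injOn`). Integrating this along radii bounds `1 / G` by a power of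
  `1 / (1 - |z|)`, and so `F = G ^ (-1 / N)` by a small power.
* Since `φ - c` is injective, a change of variables bounds the Dirichlet integral of `F` over
  `|z| < r` by an integral of `|w| ^ (-2 - ε)` over an exterior of a small disc, which is
  `O((1 - r) ^ (-1 / 2))` (`exists_lintegral_norm_deriv_sq_mul_rpow_le`).
* By Parseval's identity such a bound on Dirichlet integrals implies `F ∈ H²`
  (`exists_hardyEval_of_lintegral_deriv_le`).
-/

open Metric Set Filter Topology MeasureTheory

/-! ### Discs in the image of a holomorphic function -/

/-- If `‖f'‖ ≤ 2 ‖f' a‖` on a disc about `a`, then `f` stays close to its linear part at `a`, and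
its image contains a disc of radius comparable to `‖f' a‖` times the radius. -/
theorem ball_subset_image_of_norm_deriv_le {f : ℂ → ℂ} {a : ℂ} {t : ℝ} (ht : 0 < t)
    (hf : DifferentiableOn ℂ f (ball a t)) (hd : deriv f a ≠ 0)
    (hb : ∀ z ∈ ball a t, ‖deriv f z‖ ≤ 2 * ‖deriv f a‖) :
    ball (f a) (‖deriv f a‖ * t / 32) ⊆ f '' ball a t := by
  set A := ‖deriv f a‖ with hA
  have hA0 : 0 < A := norm_pos_iff.2 hd
  have hfd : ∀ z ∈ ball a t, DifferentiableAt ℂ f z := fun z hz =>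
    hf.differentiableAt (isOpen_ball.mem_nhds hz)
  have hsch : ∀ z ∈ ball a t, ‖deriv f z - deriv f a‖ ≤ 4 * A / t * ‖z - a‖ := by
    intro z hz
    have h := Complex.dist_le_div_mul_dist_of_mapsTo_ball (R₂ := 4 * A)
      (hf.deriv isOpen_ball) (fun w hw => by
        rw [mem_closedBall_iff_norm]
        have := norm_sub_le (deriv f w) (deriv f a)
        linarith [hb w hw]) hz
    simpa [dist_eq_norm] using h
  have hsub : closedBall a (t / 8) ⊆ ball a t := closedBall_subset_ball (by linarith)
  have hlin : ∀ z ∈ closedBall a (t / 8),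
      ‖(f z - deriv f a * z) - (f a - deriv f a * a)‖ ≤ A / 2 * ‖z - a‖ := by
    intro z hz
    refine (convex_closedBall a (t / 8)).norm_image_sub_le_of_norm_hasDerivWithin_le
      (f := fun z => f z - deriv f a * z) (f' := fun z => deriv f z - deriv f a) ?_ ?_
      (mem_closedBall_self (by linarith)) hz
    · intro w hw
      have h2 := ((hasDerivAt_id w).const_mul (deriv f a))
      simp only [id, mul_one] at h2
      exact ((hfd w (hsub hw)).hasDerivAt.sub h2).hasDerivWithinAt
    · intro w hw
      refine (hsch w (hsub hw)).trans ?_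
      rw [mem_closedBall_iff_norm] at hw
      calc 4 * A / t * ‖w - a‖ ≤ 4 * A / t * (t / 8) := by gcongr
        _ = A / 2 := by field_simp; norm_num
  have hsphere : ∀ z ∈ sphere a (t / 8), A * t / 16 ≤ ‖f z - f a‖ := by
    intro z hz
    have h1 := hlin z (sphere_subset_closedBall hz)
    rw [mem_sphere_iff_norm] at hz
    have h2 : ‖deriv f a * (z - a)‖ ≤ ‖f z - f a‖ +
        ‖(f z - deriv f a * z) - (f a - deriv f a * a)‖ := by
      have := norm_sub_le (f z - f a) ((f z - deriv f a * z) - (f a - deriv f a * a))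
      refine le_trans (le_of_eq ?_) this
      congr 1; ring
    rw [norm_mul, ← hA, hz] at h2
    rw [hz] at h1
    linarith
  have hdc : DiffContOnCl ℂ f (ball a (t / 8)) := (hf.mono hsub).diffContOnCl_ball subset_rfl
  have := hdc.ball_subset_image_closedBall (by linarith) hsphere (by
    have := (hfd a (mem_ball_self ht)).hasDerivAt.eventually_ne (c := f a) hd
    exact this.frequently.filter_mono nhdsWithin_le_nhds)
  rw [show A * t / 16 / 2 = A * t / 32 by ring] at this
  exact this.trans (image_mono hsub)

/-- A version of **Bloch's theorem**: the image of a disc of radius `R` under a holomorphic function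
contains a disc of radius comparable to `R ‖f' z₀‖`. The disc is found around the image of a point
that maximises `‖f' z‖ (R / 2 - ‖z - z₀‖)`. -/
theorem exists_ball_subset_image_ball {f : ℂ → ℂ} {z₀ : ℂ} {R : ℝ} (hR : 0 < R)
    (hf : DifferentiableOn ℂ f (ball z₀ R)) :
    ∃ w, ball w (‖deriv f z₀‖ * R / 128) ⊆ f '' ball z₀ R := by
  by_cases h0 : deriv f z₀ = 0
  · exact ⟨0, by simp [h0]⟩
  have hsub : closedBall z₀ (R / 2) ⊆ ball z₀ R := closedBall_subset_ball (by linarith)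
  have hcont : ContinuousOn (fun z => ‖deriv f z‖ * (R / 2 - ‖z - z₀‖)) (closedBall z₀ (R / 2)) :=
    (((hf.deriv isOpen_ball).continuousOn.mono hsub).norm).mul (by fun_prop)
  obtain ⟨a, ha, hmax⟩ := (isCompact_closedBall z₀ (R / 2)).exists_isMaxOn
    ⟨z₀, mem_closedBall_self (by linarith)⟩ hcont
  have hz₀ := hmax (mem_closedBall_self (by linarith : (0:ℝ) ≤ R / 2))
  simp only [mem_ofPred_eq, sub_self, norm_zero, sub_zero] at hz₀
  have hpos : 0 < ‖deriv f z₀‖ * (R / 2) := by have := norm_pos_iff.2 h0; positivity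
  have hprod := hpos.trans_le hz₀
  have hda : 0 < ‖deriv f a‖ := pos_of_mul_pos_left hprod (by
    rw [mem_closedBall_iff_norm] at ha; linarith)
  have ht0 : 0 < R / 2 - ‖a - z₀‖ := pos_of_mul_pos_right hprod hda.le
  set t := (R / 2 - ‖a - z₀‖) / 2 with ht
  have hmem : ∀ z ∈ ball a t, t ≤ R / 2 - ‖z - z₀‖ := by
    intro z hz
    rw [mem_ball_iff_norm] at hz
    have := norm_sub_le_norm_sub_add_norm_sub z a z₀
    linarith
  have hat : ball a t ⊆ closedBall z₀ (R / 2) := by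
    intro z hz
    rw [mem_closedBall_iff_norm]
    linarith [hmem z hz]
  have key := ball_subset_image_of_norm_deriv_le (f := f) (a := a) (t := t) (by linarith)
    (hf.mono (hat.trans hsub)) (norm_pos_iff.1 hda) (by
      intro z hz
      have h1 := hmax (hat hz)
      simp only [mem_ofPred_eq] at h1
      have h2 : ‖deriv f z‖ * t ≤ ‖deriv f z‖ * (R / 2 - ‖z - z₀‖) := by
        gcongr; exact hmem z hz
      have h3 : ‖deriv f z‖ * t ≤ (2 * ‖deriv f a‖) * t := by
        have : R / 2 - ‖a - z₀‖ = 2 * t := by rw [ht]; ring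
        rw [this] at h1
        linarith
      exact le_of_mul_le_mul_right h3 (by linarith))
  refine ⟨f a, (ball_subset_ball ?_).trans (key.trans (image_mono (hat.trans hsub)))⟩
  have : R / 2 - ‖a - z₀‖ = 2 * t := by rw [ht]; ring
  rw [this] at hz₀
  linarith

/-! ### Logarithmic derivatives of univalent functions -/

/-- A zero-free holomorphic function on a disc has a holomorphic logarithm. -/
theorem exists_differentiableOn_exp_eq {f : ℂ → ℂ} {c : ℂ} {R : ℝ} (hR : 0 < R)
    (hf : DifferentiableOn ℂ f (ball c R)) (h0 : ∀ z ∈ ball c R, f z ≠ 0) :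
    ∃ g : ℂ → ℂ, (∀ z ∈ ball c R, HasDerivAt g (deriv f z / f z) z) ∧
      ∀ z ∈ ball c R, Complex.exp (g z) = f z := by
  obtain ⟨g, hgc, hg⟩ := (((hf.deriv isOpen_ball).div hf h0).isExactOn_ball).with_val_at c
    (Complex.log (f c))
  have hc := mem_ball_self hR (x := c)
  have hder : ∀ z ∈ ball c R, HasDerivAt (fun z => f z * Complex.exp (-g z)) 0 z := by
    intro z hz
    have h1 := (hf.differentiableAt (isOpen_ball.mem_nhds hz)).hasDerivAt
    refine (h1.mul (hg z hz).neg.cexp).congr_deriv ?_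
    have := h0 z hz
    rw [Pi.div_apply]
    field_simp
    ring
  refine ⟨g, hg, fun z hz => ?_⟩
  have h := isOpen_ball.is_const_of_deriv_eq_zero (convex_ball c R).isPreconnected
    (fun w hw => (hder w hw).differentiableAt.differentiableWithinAt)
    (fun w hw => (hder w hw).deriv) hz hc
  simp only [hgc, Complex.exp_neg, Complex.exp_log (h0 c hc), mul_inv_cancel₀ (h0 c hc)] at h
  have h2 := Complex.exp_ne_zero (g z)
  field_simp at h
  exact h.symm

/-- A zero-free univalent function on a disc of radius `R` has logarithmic derivative `O(1 / R)` at
the centre: its logarithm takes no two values that differ by `2πi`, so that the disc which Bloch's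
theorem provides in the image of the logarithm has radius at most `π`. -/
theorem norm_logDeriv_le_of_injOn {f : ℂ → ℂ} {c : ℂ} {R : ℝ} (hR : 0 < R)
    (hf : DifferentiableOn ℂ f (ball c R)) (h0 : ∀ z ∈ ball c R, f z ≠ 0)
    (hinj : InjOn f (ball c R)) : ‖deriv f c / f c‖ ≤ 128 * Real.pi / R := by
  obtain ⟨g, hg, hexp⟩ := exists_differentiableOn_exp_eq hR hf h0
  obtain ⟨w, hw⟩ := exists_ball_subset_image_ball hR
    (fun z hz => (hg z hz).differentiableAt.differentiableWithinAt)
  rw [(hg c (mem_ball_self hR)).deriv] at hw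
  by_contra! hlt
  rw [div_lt_iff₀ hR] at hlt
  have hmem : ∀ s : ℝ, |s| = Real.pi → w + s * Complex.I ∈
      ball w (‖deriv f c / f c‖ * R / 128) := by
    intro s hs
    rw [mem_ball_iff_norm]
    simp only [add_sub_cancel_left, norm_mul, Complex.norm_I, mul_one, Complex.norm_real,
      Real.norm_eq_abs, hs]
    linarith
  obtain ⟨z₁, hz₁, e₁⟩ := hw (hmem Real.pi (abs_of_pos Real.pi_pos))
  obtain ⟨z₂, hz₂, e₂⟩ := hw (hmem (-Real.pi) (by rw [abs_neg, abs_of_pos Real.pi_pos]))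
  have he : g z₁ = g z₂ + 2 * Real.pi * Complex.I := by
    rw [e₁, e₂]; push_cast; ring
  have hff : f z₁ = f z₂ := by
    rw [← hexp z₁ hz₁, ← hexp z₂ hz₂, he, Complex.exp_add, Complex.exp_two_pi_mul_I, mul_one]
  rw [hinj hz₁ hz₂ hff] at he
  have : (2 * Real.pi * Complex.I : ℂ) = 0 := by linear_combination -he
  exact Complex.two_pi_I_ne_zero this

/-- Integrating the bound `‖g'(z)‖ ≤ C / (1 - ‖z‖)` along radii. -/
theorem norm_le_of_norm_deriv_le_div_one_sub {g : ℂ → ℂ} {C : ℝ}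
    (hg : DifferentiableOn ℂ g (ball 0 1))
    (hC : ∀ z ∈ ball (0 : ℂ) 1, ‖deriv g z‖ ≤ C / (1 - ‖z‖)) {z : ℂ} (hz : z ∈ ball (0 : ℂ) 1) :
    ‖g z‖ ≤ ‖g 0‖ + C * -Real.log (1 - ‖z‖) := by
  rw [mem_ball_zero_iff] at hz
  have hmem : ∀ t ∈ Icc (0 : ℝ) 1, ‖(t : ℂ) * z‖ < 1 ∧ ‖(t : ℂ) * z‖ = t * ‖z‖ := by
    intro t ht
    have e : ‖(t : ℂ) * z‖ = t * ‖z‖ := by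
      rw [norm_mul, Complex.norm_real, Real.norm_eq_abs, abs_of_nonneg ht.1]
    exact ⟨e ▸ (mul_le_of_le_one_left (norm_nonneg z) ht.2).trans_lt hz, e⟩
  have hder : ∀ t ∈ Icc (0 : ℝ) 1,
      HasDerivAt (fun t : ℝ => g (t * z)) (deriv g (t * z) * z) t := by
    intro t ht
    have h1 := (hg.differentiableAt (isOpen_ball.mem_nhds
      (mem_ball_zero_iff.2 (hmem t ht).1))).hasDerivAt
    have h2 : HasDerivAt (fun t : ℝ => (t : ℂ) * z) z t := by
      simpa using (Complex.ofRealCLM.hasDerivAt (x := t)).mul_const z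
    exact HasDerivAt.comp t h1 h2
  have hpos : ∀ t ∈ Icc (0 : ℝ) 1, 0 < 1 - t * ‖z‖ := fun t ht => by
    have := hmem t ht; linarith [this.1, this.2]
  have hB : ∀ t ∈ Icc (0 : ℝ) 1, HasDerivAt
      (fun t : ℝ => ‖g 0‖ + C * -Real.log (1 - t * ‖z‖)) (C / (1 - t * ‖z‖) * ‖z‖) t := by
    intro t ht
    have h1 : HasDerivAt (fun t : ℝ => 1 - t * ‖z‖) (-‖z‖) t := by
      simpa using ((hasDerivAt_id t).mul_const ‖z‖).const_sub 1
    refine (((h1.log (hpos t ht).ne').neg.const_mul C).const_add ‖g 0‖).congr_deriv ?_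
    ring
  have := image_norm_le_of_norm_deriv_right_le_deriv_boundary' (a := (0 : ℝ)) (b := 1)
    (fun t ht => (hder t ht).continuousAt.continuousWithinAt)
    (fun t ht => (hder t (Ico_subset_Icc_self ht)).hasDerivWithinAt)
    (B := fun t : ℝ => ‖g 0‖ + C * -Real.log (1 - t * ‖z‖)) (by simp)
    (fun t ht => (hB t ht).continuousAt.continuousWithinAt)
    (fun t ht => (hB t (Ico_subset_Icc_self ht)).hasDerivWithinAt) (by
      intro t ht
      have h := hmem t (Ico_subset_Icc_self ht)
      rw [norm_mul, ← h.2]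
      gcongr
      exact hC _ (mem_ball_zero_iff.2 h.1)) (right_mem_Icc.2 zero_le_one)
  simpa using this

/-! ### Area integrals -/

/-- The part of Parseval's identity for the area integral of `‖f‖²` over a disc that is needed:
`∫ ‖f‖² ≥ π ∑ ‖bₙ‖² r ^ (2n + 2) / (n + 1)`, for partial sums. -/
theorem sum_sq_le_lintegral_ball {f : ℂ → ℂ} (hf : DifferentiableOn ℂ f (ball 0 1)) {b : ℕ → ℂ}
    (hb : ∀ z ∈ ball (0 : ℂ) 1, HasSum (fun n => b n * z ^ n) (f z)) {r : ℝ} (h0 : 0 < r)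
    (h1 : r < 1) (s : Finset ℕ) :
    ENNReal.ofReal (Real.pi * ∑ n ∈ s, ‖b n‖ ^ 2 * (r ^ (2 * n + 2) / (n + 1))) ≤
      ∫⁻ z in ball (0 : ℂ) r, ENNReal.ofReal (‖f z‖ ^ 2) := by
  classical
  have hsub : ball (0 : ℂ) r ⊆ ball 0 1 := ball_subset_ball h1.le
  set u : ℂ → ENNReal := (ball (0 : ℂ) r).indicator fun z => ENNReal.ofReal (‖f z‖ ^ 2) with hu
  have hum : Measurable u := by
    rw [hu, ← piecewise_eq_indicator]
    refine ContinuousOn.measurable_piecewise ?_ continuousOn_const measurableSet_ball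
    exact ENNReal.continuous_ofReal.comp_continuousOn ((hf.continuousOn.mono hsub).norm.pow 2)
  rw [← lintegral_indicator measurableSet_ball, ← Complex.lintegral_comp_polarCoord_symm]
  change _ ≤ ∫⁻ p in Ioi (0 : ℝ) ×ˢ Ioo (-Real.pi) Real.pi,
    ENNReal.ofReal p.1 • u (Complex.polarCoord.symm p)
  have hsymm : ∀ p : ℝ × ℝ, Complex.polarCoord.symm p = circleMap 0 p.1 p.2 := by
    intro p
    rw [Complex.polarCoord_symm_apply, circleMap_zero, Complex.exp_mul_I]
    push_cast; rfl
  have hmeas : Measurable fun p : ℝ × ℝ =>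
      ENNReal.ofReal p.1 • u (Complex.polarCoord.symm p) := by
    simp_rw [hsymm, smul_eq_mul]
    refine (by fun_prop : Measurable fun p : ℝ × ℝ => ENNReal.ofReal p.1).mul (hum.comp ?_)
    simp only [circleMap_zero]
    fun_prop
  rw [Measure.volume_eq_prod, setLIntegral_prod _ hmeas.aemeasurable]
  have hpi : -Real.pi ≤ Real.pi := by linarith [Real.pi_pos]
  set q : ℝ → ℝ := fun t => 2 * Real.pi * ∑ n ∈ s, ‖b n‖ ^ 2 * t ^ (2 * n + 1) with hq
  have hinner : ∀ t ∈ Ioo 0 r, ENNReal.ofReal (q t) ≤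
      ∫⁻ θ in Ioo (-Real.pi) Real.pi,
        ENNReal.ofReal t • u (Complex.polarCoord.symm (t, θ)) := by
    intro t ht
    have hmem : ∀ θ, circleMap 0 t θ ∈ ball (0 : ℂ) r := fun θ => by
      rw [mem_ball_zero_iff, norm_circleMap_zero, abs_of_pos ht.1]; exact ht.2
    have hcont : Continuous fun θ => t * ‖f (circleMap 0 t θ)‖ ^ 2 :=
      continuous_const.mul (((hf.continuousOn.comp_continuous (continuous_circleMap 0 t)
        (fun θ => hsub (hmem θ))).norm).pow 2)
    have hval : ∀ θ, ENNReal.ofReal t • u (Complex.polarCoord.symm (t, θ)) =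
        ENNReal.ofReal (t * ‖f (circleMap 0 t θ)‖ ^ 2) := by
      intro θ
      rw [hsymm, smul_eq_mul, hu, indicator_of_mem (hmem θ), ENNReal.ofReal_mul ht.1.le]
    simp_rw [hval]
    rw [← ofReal_integral_eq_lintegral_ofReal
      ((hcont.integrableOn_Icc (a := -Real.pi) (b := Real.pi)).mono_set Ioo_subset_Icc_self)
      (Eventually.of_forall fun θ => by have := ht.1; positivity),
      ← integral_Ioc_eq_integral_Ioo, ← intervalIntegral.integral_of_le hpi,
      intervalIntegral.integral_const_mul]
    have hca : ∫ θ in (-Real.pi)..Real.pi, ‖f (circleMap 0 t θ)‖ ^ 2 =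
        2 * Real.pi * Real.circleAverage (fun z => ‖f z‖ ^ 2) 0 t := by
      rw [Real.circleAverage_eq_integral_add (-Real.pi), smul_eq_mul,
        intervalIntegral.integral_comp_add_right (fun θ => ‖f (circleMap 0 t θ)‖ ^ 2)]
      rw [zero_add, show 2 * Real.pi + -Real.pi = Real.pi by ring]
      field_simp
    have habs : Summable fun n => ‖b n‖ * t ^ n := by
      have h := (hb (t : ℂ) (by
        rw [mem_ball_zero_iff]; simpa [abs_of_pos ht.1] using ht.2.trans h1)).summable.norm
      simpa [abs_of_pos ht.1] using h
    have hP := hasSum_sq_circleAverage ht.1.le habs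
      (fun z hz => hb z (by rw [mem_ball_zero_iff, hz]; exact ht.2.trans h1))
    have hle := sum_le_hasSum s (fun n _ => by have := ht.1; positivity) hP
    refine ENNReal.ofReal_le_ofReal ?_
    rw [hca, hq]
    calc 2 * Real.pi * ∑ n ∈ s, ‖b n‖ ^ 2 * t ^ (2 * n + 1)
        = t * (2 * Real.pi * ∑ n ∈ s, ‖b n‖ ^ 2 * t ^ (2 * n)) := by
          simp only [Finset.mul_sum]
          exact Finset.sum_congr rfl fun n _ => by ring
      _ ≤ _ := by have := ht.1; gcongr
  have hqc : Continuous q := by fun_prop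
  have hint : ∫ t in Ioo 0 r, q t =
      Real.pi * ∑ n ∈ s, ‖b n‖ ^ 2 * (r ^ (2 * n + 2) / (n + 1)) := by
    rw [← integral_Ioc_eq_integral_Ioo, ← intervalIntegral.integral_of_le h0.le, hq,
      intervalIntegral.integral_const_mul, intervalIntegral.integral_finsetSum
        (fun n _ => (by fun_prop : Continuous fun t : ℝ => ‖b n‖ ^ 2 * t ^ (2 * n + 1)
          ).intervalIntegrable _ _)]
    simp only [Finset.mul_sum]
    refine Finset.sum_congr rfl fun n _ => ?_
    rw [intervalIntegral.integral_const_mul, integral_pow]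
    have : (n : ℝ) + 1 ≠ 0 := by positivity
    push_cast
    field_simp
    ring
  rw [← hint, ofReal_integral_eq_lintegral_ofReal
    ((hqc.integrableOn_Icc (a := 0) (b := r)).mono_set Ioo_subset_Icc_self)
    ((ae_restrict_iff' measurableSet_Ioo).2 (Eventually.of_forall fun t ht => by
      have := ht.1
      simp only [hq, Pi.zero_apply]; positivity))]
  calc ∫⁻ t in Ioo 0 r, ENNReal.ofReal (q t)
      ≤ ∫⁻ t in Ioo 0 r, ∫⁻ θ in Ioo (-Real.pi) Real.pi,
          ENNReal.ofReal t • u (Complex.polarCoord.symm (t, θ)) :=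
        setLIntegral_mono' measurableSet_Ioo hinner
    _ ≤ _ := lintegral_mono_set Ioo_subset_Ioi_self

/-- A holomorphic function whose Dirichlet integral over the disc of radius `r` is
`O((1 - r) ^ (-1/2))` belongs to `H²`. -/
theorem exists_hardyEval_of_lintegral_deriv_le {F : ℂ → ℂ}
    (hF : DifferentiableOn ℂ F (ball 0 1)) {C : ℝ} (hC0 : 0 ≤ C)
    (hC : ∀ r : ℝ, 0 < r → r < 1 → ∫⁻ z in ball (0 : ℂ) r, ENNReal.ofReal (‖deriv F z‖ ^ 2) ≤
      ENNReal.ofReal (C * (1 - r) ^ (-(1 / 2) : ℝ))) :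
    ∃ f : HardySpace, ∀ z ∈ ball (0 : ℂ) 1, hardyEval f z = F z := by
  set a : ℕ → ℂ := fun n => (n.factorial : ℂ)⁻¹ * iteratedDeriv n F 0 with ha
  have hsum : ∀ z ∈ ball (0 : ℂ) 1, HasSum (fun n => a n * z ^ n) (F z) := by
    intro z hz
    refine (Complex.hasSum_taylorSeries_on_ball hF hz).congr_fun fun n => ?_
    simp only [ha, smul_eq_mul, sub_zero]
    ring
  have hdsum : ∀ z ∈ ball (0 : ℂ) 1,
      HasSum (fun n : ℕ => ((n + 1 : ℕ) * a (n + 1)) * z ^ n) (deriv F z) := by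
    intro z hz
    refine (Complex.hasSum_taylorSeries_on_ball (hF.deriv isOpen_ball) hz).congr_fun fun n => ?_
    simp only [ha, smul_eq_mul, sub_zero, iteratedDeriv_succ', Nat.factorial_succ]
    have h1 : ((n : ℂ) + 1) ≠ 0 := by exact_mod_cast n.succ_ne_zero
    push_cast
    field_simp
  have hr : ∀ (s : Finset ℕ) (r : ℝ), 0 < r → r < 1 →
      Real.pi * ∑ n ∈ s, (n + 1) * ‖a (n + 1)‖ ^ 2 * r ^ (2 * n + 2) ≤
        C * (1 - r) ^ (-(1 / 2) : ℝ) := by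
    intro s r h0 h1
    have h := (sum_sq_le_lintegral_ball (hF.deriv isOpen_ball) hdsum h0 h1 s).trans (hC r h0 h1)
    rw [ENNReal.ofReal_le_ofReal_iff
      (mul_nonneg hC0 (Real.rpow_nonneg (by linarith) _))] at h
    refine le_of_eq_of_le ?_ h
    congr 1
    refine Finset.sum_congr rfl fun n _ => ?_
    have h2 : (n : ℝ) + 1 ≠ 0 := by positivity
    have h3 : ‖((n + 1 : ℕ) : ℂ) * a (n + 1)‖ = (n + 1) * ‖a (n + 1)‖ := by
      rw [norm_mul, Complex.norm_natCast, Nat.cast_succ]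
    rw [h3]
    field_simp
  -- Integrating in `r` turns the weights `(n + 1) r ^ (2n + 2)` into numbers bounded below by `1/3`.
  have hfin : ∀ s : Finset ℕ, ∑ n ∈ s, ‖a (n + 1)‖ ^ 2 ≤ 6 * C / Real.pi := by
    intro s
    have hI : ∫ r in (0 : ℝ)..1, (1 - r) ^ (-(1 / 2) : ℝ) = 2 := by
      rw [intervalIntegral.integral_comp_sub_left (fun r : ℝ => r ^ (-(1 / 2) : ℝ)),
        sub_self, sub_zero, integral_rpow (Or.inl (by norm_num))]
      norm_num
    have hInt : IntervalIntegrable (fun r : ℝ => (1 - r) ^ (-(1 / 2) : ℝ)) volume 0 1 := by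
      have := (intervalIntegral.intervalIntegrable_rpow' (a := 1) (b := 0)
        (by norm_num : (-1 : ℝ) < -(1 / 2))).comp_sub_left 1
      simpa using this
    have hle := intervalIntegral.integral_mono_on_of_le_Ioo (zero_le_one' ℝ)
      (Continuous.intervalIntegrable (by fun_prop) 0 1) (hInt.const_mul C)
      (fun r hr' => hr s r hr'.1 hr'.2)
    rw [intervalIntegral.integral_const_mul, intervalIntegral.integral_const_mul, hI,
      intervalIntegral.integral_finsetSum
        (fun n _ => Continuous.intervalIntegrable (by fun_prop) _ _)] at hle
    have hterm : ∀ n ∈ s, ‖a (n + 1)‖ ^ 2 / 3 ≤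
        ∫ r in (0 : ℝ)..1, ((n : ℝ) + 1) * ‖a (n + 1)‖ ^ 2 * r ^ (2 * n + 2) := by
      intro n _
      rw [intervalIntegral.integral_const_mul, integral_pow]
      have hn : (0 : ℝ) ≤ n := Nat.cast_nonneg n
      have : (1 : ℝ) / 3 ≤ (n + 1) * ((1 ^ (2 * n + 2 + 1) - 0 ^ (2 * n + 2 + 1)) /
          (((2 * n + 2 : ℕ) : ℝ) + 1)) := by
        push_cast
        rw [one_pow, zero_pow (by omega), sub_zero, mul_one_div,
          div_le_div_iff₀ (by norm_num) (by linarith)]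
        linarith
      calc ‖a (n + 1)‖ ^ 2 / 3 = ‖a (n + 1)‖ ^ 2 * (1 / 3) := by ring
        _ ≤ ‖a (n + 1)‖ ^ 2 * _ := mul_le_mul_of_nonneg_left this (by positivity)
        _ = _ := by ring
    have h3 := Finset.sum_le_sum hterm
    rw [← Finset.sum_div] at h3
    have hpi := Real.pi_pos
    rw [le_div_iff₀ hpi]
    nlinarith [mul_le_mul_of_nonneg_left h3 hpi.le]
  have hsm : Summable fun n => ‖a n‖ ^ 2 :=
    (summable_nat_add_iff 1).1 (summable_of_sum_le (fun n => by positivity) hfin)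
  have hmem : Memℓp a 2 := memℓp_gen (by simpa using hsm)
  exact ⟨⟨a, hmem⟩, fun z hz => (hsum z hz).tsum_eq⟩

/-- Change of variables for an injective holomorphic map `f` with `δ ≤ ‖f‖`: the integral of
`‖f'‖² ‖f‖ ^ (-2 - ε)` is at most that of `‖w‖ ^ (-2 - ε)` over `δ ≤ ‖w‖`, and so `O(δ ^ (-ε))`.
Replacing `f` by `f / δ` reduces the bound to `δ = 1`, where `‖w‖` is comparable to `1 + ‖w‖`. -/
theorem exists_lintegral_norm_deriv_sq_mul_rpow_le {ε : ℝ} (hε : 0 < ε) :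
    ∃ C : ℝ, 0 ≤ C ∧ ∀ (f : ℂ → ℂ) (U : Set ℂ), IsOpen U → DifferentiableOn ℂ f U → InjOn f U →
      ∀ δ : ℝ, 0 < δ → (∀ z ∈ U, δ ≤ ‖f z‖) →
        ∫⁻ z in U, ENNReal.ofReal (‖deriv f z‖ ^ 2 * ‖f z‖ ^ (-(2 + ε))) ≤
          ENNReal.ofReal (C * δ ^ (-ε)) := by
  set J : ENNReal := ∫⁻ w : ℂ, ENNReal.ofReal ((1 + ‖w‖) ^ (-(2 + ε))) with hJ
  have hJfin : J < ⊤ := finite_integral_one_add_norm (by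
    rw [Complex.finrank_real_complex]; push_cast; linarith)
  refine ⟨2 ^ (2 + ε) * J.toReal, by positivity, ?_⟩
  intro f U hU hf hinj δ hδ hfδ
  set h : ℂ → ℂ := fun z => (δ : ℂ)⁻¹ * f z with hh
  have hδc : (δ : ℂ)⁻¹ ≠ 0 := inv_ne_zero (by exact_mod_cast hδ.ne')
  have hhinj : InjOn h U := fun x hx y hy hxy => hinj hx hy (mul_left_cancel₀ hδc hxy)
  have hder : ∀ z ∈ U, HasDerivAt h ((δ : ℂ)⁻¹ * deriv f z) z := fun z hz =>
    ((hf.differentiableAt (hU.mem_nhds hz)).hasDerivAt).const_mul _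
  have hnorm : ∀ z, ‖h z‖ = δ⁻¹ * ‖f z‖ := fun z => by
    simp [hh, abs_of_pos hδ]
  have hcv := lintegral_image_eq_lintegral_abs_det_fderiv_mul volume hU.measurableSet
    (fun z hz => ((hder z hz).hasFDerivAt.restrictScalars ℝ).hasFDerivWithinAt) hhinj
    (fun w => ENNReal.ofReal ((1 + ‖w‖) ^ (-(2 + ε))))
  have hdet : ∀ c : ℂ, |((ContinuousLinearMap.toSpanSingleton ℂ c).restrictScalars ℝ).det| =
      ‖c‖ ^ 2 := by
    intro c
    simp [ContinuousLinearMap.det, LinearMap.det_restrictScalars, Algebra.norm_complex_eq,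
      Complex.normSq_eq_norm_sq]
  have hpt : ∀ z ∈ U, ENNReal.ofReal (‖deriv f z‖ ^ 2 * ‖f z‖ ^ (-(2 + ε))) ≤
      ENNReal.ofReal (2 ^ (2 + ε) * δ ^ (-ε)) *
        (ENNReal.ofReal (‖(δ : ℂ)⁻¹ * deriv f z‖ ^ 2) *
          ENNReal.ofReal ((1 + ‖h z‖) ^ (-(2 + ε)))) := by
    intro z hz
    rw [← ENNReal.ofReal_mul (by positivity), ← ENNReal.ofReal_mul (by positivity)]
    refine ENNReal.ofReal_le_ofReal ?_
    have h1 : 1 ≤ ‖h z‖ := by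
      rw [hnorm, ← div_eq_inv_mul, one_le_div hδ]; exact hfδ z hz
    have h2 : (2 * ‖h z‖) ^ (-(2 + ε)) ≤ (1 + ‖h z‖) ^ (-(2 + ε)) :=
      Real.rpow_le_rpow_of_nonpos (by linarith) (by linarith) (by linarith)
    have h3 : ‖f z‖ = δ * ‖h z‖ := by rw [hnorm]; field_simp
    have h4 : (2 : ℝ) ^ (2 + ε) * 2 ^ (-(2 + ε)) = 1 := by
      rw [← Real.rpow_add (by norm_num)]; simp
    have h5 : δ ^ (-(2 + ε)) = δ ^ (-ε) * (δ⁻¹) ^ 2 := by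
      rw [show -(2 + ε) = -ε + (-2 : ℝ) by ring, Real.rpow_add hδ, Real.rpow_neg hδ.le 2,
        Real.rpow_two, inv_pow]
    have h6 : ‖(δ : ℂ)⁻¹ * deriv f z‖ = δ⁻¹ * ‖deriv f z‖ := by
      simp [abs_of_pos hδ]
    calc ‖deriv f z‖ ^ 2 * ‖f z‖ ^ (-(2 + ε))
        = ‖deriv f z‖ ^ 2 * (δ ^ (-ε) * (δ⁻¹) ^ 2 * ‖h z‖ ^ (-(2 + ε))) := by
          rw [h3, Real.mul_rpow hδ.le (norm_nonneg _), h5]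
      _ = 2 ^ (2 + ε) * δ ^ (-ε) * ((δ⁻¹ * ‖deriv f z‖) ^ 2 * (2 * ‖h z‖) ^ (-(2 + ε))) := by
          rw [Real.mul_rpow (by norm_num) (norm_nonneg _)]
          linear_combination -(‖deriv f z‖ ^ 2 * (δ ^ (-ε) * (δ⁻¹) ^ 2 * ‖h z‖ ^ (-(2 + ε)))) * h4
      _ ≤ 2 ^ (2 + ε) * δ ^ (-ε) * ((δ⁻¹ * ‖deriv f z‖) ^ 2 * (1 + ‖h z‖) ^ (-(2 + ε))) := by
          gcongr
      _ = _ := by rw [h6]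
  calc ∫⁻ z in U, ENNReal.ofReal (‖deriv f z‖ ^ 2 * ‖f z‖ ^ (-(2 + ε)))
      ≤ ∫⁻ z in U, ENNReal.ofReal (2 ^ (2 + ε) * δ ^ (-ε)) *
        (ENNReal.ofReal (‖(δ : ℂ)⁻¹ * deriv f z‖ ^ 2) *
          ENNReal.ofReal ((1 + ‖h z‖) ^ (-(2 + ε)))) := setLIntegral_mono' hU.measurableSet hpt
    _ = ENNReal.ofReal (2 ^ (2 + ε) * δ ^ (-ε)) *
        ∫⁻ w in h '' U, ENNReal.ofReal ((1 + ‖w‖) ^ (-(2 + ε))) := by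
        rw [lintegral_const_mul' _ _ ENNReal.ofReal_ne_top, hcv]
        simp_rw [hdet]
    _ ≤ ENNReal.ofReal (2 ^ (2 + ε) * δ ^ (-ε)) * J := by
        gcongr
        exact setLIntegral_le_lintegral _ _
    _ = ENNReal.ofReal (2 ^ (2 + ε) * J.toReal * δ ^ (-ε)) := by
        rw [mul_right_comm, ENNReal.ofReal_mul (by positivity : 0 ≤ 2 ^ (2 + ε) * δ ^ (-ε)),
          ENNReal.ofReal_toReal hJfin.ne]

/-! ### Membership of small negative powers in the Hardy space -/

/-- If `‖F'‖²` is dominated by `‖ζ'‖² ‖ζ‖ ^ (-2 - ε)` up to `O((1 - ‖z‖) ^ (-1/2))` near the unit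
circle, where `ζ` is univalent and not too small, then `F` belongs to `H²`. -/
theorem exists_hardyEval_of_norm_deriv_sq_le {F ζ : ℂ → ℂ} (hF : DifferentiableOn ℂ F (ball 0 1))
    (hζ : DifferentiableOn ℂ ζ (ball 0 1)) (hinj : InjOn ζ (ball 0 1))
    {r₀ ε a K κ C : ℝ} (hε : 0 < ε) (ha : 0 ≤ a) (hK : 0 ≤ K) (hκ : 0 < κ)
    (hεC : ε * C ≤ 1 / 2)
    (h1 : ∀ z ∈ ball (0 : ℂ) 1, r₀ < ‖z‖ → ‖deriv F z‖ ^ 2 ≤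
      a * (‖deriv ζ z‖ ^ 2 * ‖ζ z‖ ^ (-(2 + ε))) + K * (1 - ‖z‖) ^ (-(1 / 2) : ℝ))
    (h2 : ∀ z ∈ ball (0 : ℂ) 1, ‖z‖ ≤ r₀ →
      ‖deriv F z‖ ^ 2 ≤ K * (1 - ‖z‖) ^ (-(1 / 2) : ℝ))
    (h3 : ∀ z ∈ ball (0 : ℂ) 1, r₀ < ‖z‖ → κ * (1 - ‖z‖) ^ C ≤ ‖ζ z‖) (hC : 0 ≤ C) :
    ∃ f : HardySpace, ∀ z ∈ ball (0 : ℂ) 1, hardyEval f z = F z := by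
  obtain ⟨A, hA0, hA⟩ := exists_lintegral_norm_deriv_sq_mul_rpow_le hε
  set V : ℝ := (volume (ball (0 : ℂ) 1)).toReal with hV
  have hVfin : volume (ball (0 : ℂ) 1) ≠ ⊤ := measure_ball_lt_top.ne
  refine exists_hardyEval_of_lintegral_deriv_le hF
    (C := a * (A * κ ^ (-ε)) + K * V) (by positivity) ?_
  intro r hr0 hr1
  have h1r : 0 < 1 - r := by linarith
  have hsub : ball (0 : ℂ) r ⊆ ball 0 1 := ball_subset_ball hr1.le
  set P : ℝ := (1 - r) ^ (-(1 / 2) : ℝ) with hP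
  have hP0 : 0 ≤ P := by positivity
  have hPz : ∀ z ∈ ball (0 : ℂ) r, (1 - ‖z‖) ^ (-(1 / 2) : ℝ) ≤ P := by
    intro z hz
    rw [mem_ball_zero_iff] at hz
    exact Real.rpow_le_rpow_of_nonpos h1r (by linarith) (by norm_num)
  set U : Set ℂ := ball 0 r ∩ {z | r₀ < ‖z‖} with hU
  have hUo : IsOpen U := isOpen_ball.inter (isOpen_lt continuous_const continuous_norm)
  have hU1 : U ⊆ ball 0 1 := inter_subset_left.trans hsub
  set W : ℂ → ENNReal := fun z => ENNReal.ofReal (‖deriv ζ z‖ ^ 2 * ‖ζ z‖ ^ (-(2 + ε)))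
  have hW : ∫⁻ z in U, W z ≤ ENNReal.ofReal (A * (κ ^ (-ε) * P)) := by
    refine (hA ζ U hUo (hζ.mono hU1) (hinj.mono hU1) (κ * (1 - r) ^ C) (by positivity) ?_).trans ?_
    · intro z hz
      refine le_trans ?_ (h3 z (hU1 hz) hz.2)
      have : ‖z‖ < r := mem_ball_zero_iff.1 hz.1
      gcongr
    · refine ENNReal.ofReal_le_ofReal ?_
      rw [Real.mul_rpow hκ.le (by positivity), ← Real.rpow_mul h1r.le]
      gcongr ?_ * (?_ * ?_)
      exact Real.rpow_le_rpow_of_exponent_ge h1r (by linarith) (by linarith)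
  have hcover : ∀ z ∈ ball (0 : ℂ) r, ENNReal.ofReal (‖deriv F z‖ ^ 2) ≤
      ENNReal.ofReal a * U.indicator W z + ENNReal.ofReal (K * P) := by
    intro z hz
    have hKP : K * (1 - ‖z‖) ^ (-(1 / 2) : ℝ) ≤ K * P := by gcongr; exact hPz z hz
    by_cases hzr : r₀ < ‖z‖
    · rw [indicator_of_mem (show z ∈ U from ⟨hz, hzr⟩), ← ENNReal.ofReal_mul ha,
        ← ENNReal.ofReal_add (by positivity) (by positivity)]
      exact ENNReal.ofReal_le_ofReal ((h1 z (hsub hz) hzr).trans (by gcongr))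
    · refine le_add_left (ENNReal.ofReal_le_ofReal ((h2 z (hsub hz) (not_lt.1 hzr)).trans hKP))
  calc ∫⁻ z in ball (0 : ℂ) r, ENNReal.ofReal (‖deriv F z‖ ^ 2)
      ≤ ∫⁻ z in ball (0 : ℂ) r, (ENNReal.ofReal a * U.indicator W z + ENNReal.ofReal (K * P)) :=
        setLIntegral_mono' measurableSet_ball hcover
    _ = ENNReal.ofReal a * (∫⁻ z in ball (0 : ℂ) r, U.indicator W z) +
          ENNReal.ofReal (K * P) * volume (ball (0 : ℂ) r) := by
        rw [lintegral_add_right _ measurable_const,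
          lintegral_const_mul' _ _ ENNReal.ofReal_ne_top, setLIntegral_const]
    _ ≤ ENNReal.ofReal a * ENNReal.ofReal (A * (κ ^ (-ε) * P)) +
          ENNReal.ofReal (K * P) * ENNReal.ofReal V := by
        rw [ENNReal.ofReal_toReal hVfin]
        gcongr
        refine (setLIntegral_le_lintegral _ _).trans ?_
        rwa [lintegral_indicator hUo.measurableSet]
    _ = ENNReal.ofReal ((a * (A * κ ^ (-ε)) + K * V) * P) := by
        rw [← ENNReal.ofReal_mul ha, ← ENNReal.ofReal_mul (by positivity),
          ← ENNReal.ofReal_add (by positivity) (by positivity)]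
        congr 1; ring

/-- A zero-free factor `G` of a univalent function `G B`, where `B` has no zeros near the unit
circle, has logarithmic derivative `O(1 / (1 - ‖z‖))`. -/
theorem exists_norm_logDeriv_le_of_injOn_mul {G B : ℂ → ℂ} {r₀ : ℝ}
    (hG : DifferentiableOn ℂ G (ball 0 1)) (hG0 : ∀ z ∈ ball (0 : ℂ) 1, G z ≠ 0)
    (hB : Differentiable ℂ B) (hr : r₀ < 1) (hB0 : ∀ z, r₀ ≤ ‖z‖ → ‖z‖ ≤ 1 → B z ≠ 0)
    (hinj : InjOn (fun z => G z * B z) (ball 0 1)) :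
    ∃ C : ℝ, 0 ≤ C ∧ ∀ z ∈ ball (0 : ℂ) 1, ‖deriv G z / G z‖ ≤ C / (1 - ‖z‖) := by
  set r₁ : ℝ := (1 + 2 * r₀) / 3 with hr₁
  have hr₁1 : r₁ < 1 := by rw [hr₁]; linarith
  have hsub : closedBall (0 : ℂ) r₁ ⊆ ball 0 1 := closedBall_subset_ball hr₁1
  obtain ⟨C₁, hC₁⟩ := (isCompact_closedBall (0 : ℂ) r₁).exists_bound_of_continuousOn
    ((((hG.deriv isOpen_ball).div hG hG0).continuousOn).mono hsub)
  have hBd : Differentiable ℂ (deriv B) := hB.contDiff.differentiable_deriv_two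
  obtain ⟨C₂, hC₂⟩ := ((isCompact_closedBall (0 : ℂ) 1).inter_right
    (isClosed_le (continuous_const (y := r₀)) continuous_norm)).exists_bound_of_continuousOn
    (f := fun z => deriv B z / B z) (hBd.continuous.continuousOn.div hB.continuous.continuousOn
      (fun z hz => hB0 z hz.2 (mem_closedBall_zero_iff.1 hz.1)))
  refine ⟨|C₁| + |C₂| + 256 * Real.pi, by positivity, fun z hz => ?_⟩
  have hz1 : ‖z‖ < 1 := mem_ball_zero_iff.1 hz
  have hpos : 0 < 1 - ‖z‖ := by linarith
  have hone : 1 ≤ 1 / (1 - ‖z‖) := by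
    rw [le_div_iff₀ hpos]; linarith [norm_nonneg z]
  rcases le_or_gt ‖z‖ r₁ with hle | hgt
  · calc ‖deriv G z / G z‖ ≤ |C₁| :=
          (hC₁ z (mem_closedBall_zero_iff.2 hle)).trans (le_abs_self _)
      _ ≤ |C₁| + |C₂| + 256 * Real.pi := by
          have := Real.pi_pos; linarith [abs_nonneg C₂]
      _ ≤ (|C₁| + |C₂| + 256 * Real.pi) * (1 / (1 - ‖z‖)) :=
          le_mul_of_one_le_right (by positivity) hone
      _ = _ := by ring
  · -- The disc about `z` of half the distance to the unit circle contains no zero of `B`.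
    have hsubz : ∀ w ∈ ball z ((1 - ‖z‖) / 2), r₀ ≤ ‖w‖ ∧ ‖w‖ < 1 := by
      intro w hw
      rw [mem_ball_iff_norm] at hw
      have h1 := norm_sub_norm_le z w
      have h2 := norm_sub_norm_le w z
      rw [norm_sub_rev] at h1
      constructor <;> linarith
    have hin : ball z ((1 - ‖z‖) / 2) ⊆ ball 0 1 := fun w hw =>
      mem_ball_zero_iff.2 (hsubz w hw).2
    have hζ := norm_logDeriv_le_of_injOn (f := fun z => G z * B z) (by linarith)
      ((hG.mono hin).mul hB.differentiableOn)
      (fun w hw => mul_ne_zero (hG0 w (hin hw)) (hB0 w (hsubz w hw).1 (hsubz w hw).2.le))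
      (hinj.mono hin)
    have hBz := hB0 z (by linarith) hz1.le
    have hder : deriv (fun z => G z * B z) z / (G z * B z) =
        deriv G z / G z + deriv B z / B z := by
      rw [deriv_fun_mul (hG.differentiableAt (isOpen_ball.mem_nhds hz)) (hB z)]
      have := hG0 z hz
      field_simp
    rw [hder] at hζ
    have hb : ‖deriv B z / B z‖ ≤ |C₂| := (hC₂ z ⟨mem_closedBall_zero_iff.2 hz1.le,
      (by linarith : r₀ ≤ ‖z‖)⟩).trans (le_abs_self _)
    calc ‖deriv G z / G z‖ = ‖(deriv G z / G z + deriv B z / B z) - deriv B z / B z‖ := by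
          rw [add_sub_cancel_right]
      _ ≤ ‖deriv G z / G z + deriv B z / B z‖ + ‖deriv B z / B z‖ := norm_sub_le _ _
      _ ≤ 128 * Real.pi / ((1 - ‖z‖) / 2) + |C₂| * (1 / (1 - ‖z‖)) :=
          add_le_add hζ (hb.trans (le_mul_of_one_le_right (abs_nonneg _) hone))
      _ = (|C₂| + 256 * Real.pi) / (1 - ‖z‖) := by field_simp; ring
      _ ≤ _ := by gcongr; linarith [abs_nonneg C₁]

/-- If `G B` is univalent, `G` zero-free and `B` without zeros near the unit circle, then some
branch of `G ^ (-1 / N)` belongs to `H²`. Here `E` and `f` are branches of `G ^ (1 / N)` and of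
`G ^ (-1 / N)`. -/
theorem exists_hardyEval_rpow_neg {G B : ℂ → ℂ} {r₀ : ℝ}
    (hG : DifferentiableOn ℂ G (ball 0 1)) (hG0 : ∀ z ∈ ball (0 : ℂ) 1, G z ≠ 0)
    (hB : Differentiable ℂ B) (hr : r₀ < 1) (hB0 : ∀ z, r₀ ≤ ‖z‖ → ‖z‖ ≤ 1 → B z ≠ 0)
    (hinj : InjOn (fun z => G z * B z) (ball 0 1)) :
    ∃ (N : ℕ) (E : ℂ → ℂ) (f : HardySpace), N ≠ 0 ∧ DifferentiableOn ℂ E (ball 0 1) ∧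
      (∀ z ∈ ball (0 : ℂ) 1, E z ^ N = G z) ∧
      ∀ z ∈ ball (0 : ℂ) 1, E z * hardyEval f z = 1 := by
  obtain ⟨C, hC0, hC⟩ := exists_norm_logDeriv_le_of_injOn_mul hG hG0 hB hr hB0 hinj
  obtain ⟨g, hg, hexp⟩ := exists_differentiableOn_exp_eq one_pos hG hG0
  have hgd : DifferentiableOn ℂ g (ball 0 1) := fun z hz =>
    (hg z hz).differentiableAt.differentiableWithinAt
  have hgrow : ∀ z ∈ ball (0 : ℂ) 1, ‖g z‖ ≤ ‖g 0‖ + C * -Real.log (1 - ‖z‖) := fun z hz =>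
    norm_le_of_norm_deriv_le_div_one_sub hgd (fun w hw => (hg w hw).deriv ▸ hC w hw) hz
  -- `1 / G` grows at most like `(1 - ‖z‖) ^ (-C)`; with `4 C ≤ N` the square of its `N`-th root
  -- grows at most like `(1 - ‖z‖) ^ (-1 / 2)`.
  obtain ⟨N, hN⟩ := exists_nat_ge (4 * C + 1)
  have hN0 : (0 : ℝ) < N := by linarith
  have hN1 : (1 : ℝ) ≤ N := by linarith
  have hNc : (N : ℂ) ≠ 0 := by exact_mod_cast hN0.ne'
  set ε : ℝ := (N : ℝ)⁻¹ with hε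
  have hε0 : 0 < ε := by positivity
  have hε1 : ε ≤ 1 := inv_le_one_of_one_le₀ hN1
  have hεC : ε * C ≤ 1 / 4 := by
    rw [hε, inv_mul_le_iff₀ hN0]; linarith
  set F : ℂ → ℂ := fun z => Complex.exp (-(g z / N)) with hF
  have hFd : ∀ z ∈ ball (0 : ℂ) 1, HasDerivAt F (F z * -(deriv G z / G z / N)) z := fun z hz =>
    ((hg z hz).div_const (N : ℂ)).neg.cexp
  obtain ⟨C₂, hC₂⟩ := ((isCompact_closedBall (0 : ℂ) 1).inter_right
    (isClosed_le (continuous_const (y := r₀)) continuous_norm)).exists_bound_of_continuousOn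
    (f := fun z => deriv B z / B z)
    (hB.contDiff.differentiable_deriv_two.continuous.continuousOn.div hB.continuous.continuousOn
      (fun z hz => hB0 z hz.2 (mem_closedBall_zero_iff.1 hz.1)))
  obtain ⟨C₃, hC₃⟩ := ((isCompact_closedBall (0 : ℂ) 1)).exists_bound_of_continuousOn
    hB.continuous.continuousOn
  obtain ⟨C₄, hC₄⟩ := ((isCompact_closedBall (0 : ℂ) 1).inter_right
    (isClosed_le (continuous_const (y := r₀)) continuous_norm)).exists_bound_of_continuousOn
    (f := fun z => (B z)⁻¹) (hB.continuous.continuousOn.inv₀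
      (fun z hz => hB0 z hz.2 (mem_closedBall_zero_iff.1 hz.1)))
  have hFG : ∀ z ∈ ball (0 : ℂ) 1, ‖F z‖ ^ 2 = ‖G z‖ ^ (-(2 * ε)) := by
    intro z hz
    rw [← hexp z hz, Complex.norm_exp, Complex.norm_exp, ← Real.exp_mul, ← Real.exp_nat_mul]
    congr 1
    have : (-(g z / (N : ℂ))).re = -((g z).re * ε) := by
      rw [Complex.neg_re, ← Complex.ofReal_natCast, Complex.div_ofReal_re, hε, div_eq_mul_inv]
    rw [this]; push_cast; ring
  have hre : ∀ z ∈ ball (0 : ℂ) 1, Real.exp (-‖g 0‖) * (1 - ‖z‖) ^ C ≤ ‖G z‖ := by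
    intro z hz
    have hpos : 0 < 1 - ‖z‖ := by linarith [mem_ball_zero_iff.1 hz]
    rw [← hexp z hz, Complex.norm_exp, Real.rpow_def_of_pos hpos, ← Real.exp_add]
    refine Real.exp_le_exp.2 ?_
    have h1 := hgrow z hz
    have h2 := (abs_le.1 (Complex.abs_re_le_norm (g z))).1
    linarith
  set K : ℝ := Real.exp (-‖g 0‖) ^ (-(2 * ε)) with hK
  have hK0 : 0 ≤ K := by positivity
  have hFle : ∀ z ∈ ball (0 : ℂ) 1, ‖F z‖ ^ 2 ≤ K * (1 - ‖z‖) ^ (-(1 / 2) : ℝ) := by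
    intro z hz
    have hpos : 0 < 1 - ‖z‖ := by linarith [mem_ball_zero_iff.1 hz]
    rw [hFG z hz]
    refine (Real.rpow_le_rpow_of_nonpos (by positivity) (hre z hz) (by linarith)).trans ?_
    rw [Real.mul_rpow (by positivity) (by positivity), ← Real.rpow_mul hpos.le]
    exact mul_le_mul_of_nonneg_left
      (Real.rpow_le_rpow_of_exponent_ge hpos (by linarith [norm_nonneg z]) (by linarith)) hK0
  have hdF : ∀ z ∈ ball (0 : ℂ) 1, ‖deriv F z‖ ^ 2 ≤ ‖F z‖ ^ 2 * ‖deriv G z / G z‖ ^ 2 := by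
    intro z hz
    rw [(hFd z hz).deriv, norm_mul, norm_neg, norm_div, Complex.norm_natCast, mul_pow]
    gcongr
    exact div_le_self (norm_nonneg _) hN1
  have hζd : DifferentiableOn ℂ (fun z => G z * B z) (ball 0 1) := hG.mul hB.differentiableOn
  have hFH : ∃ f : HardySpace, ∀ z ∈ ball (0 : ℂ) 1, hardyEval f z = F z := by
    refine exists_hardyEval_of_norm_deriv_sq_le (ζ := fun z => G z * B z)
      (r₀ := r₀) (ε := 2 * ε) (a := 2 * (1 + |C₃|) ^ 2)
      (K := K * ((C / (1 - r₀)) ^ 2 + 2 * C₂ ^ 2)) (κ := (1 + |C₄|)⁻¹ * Real.exp (-‖g 0‖)) (C := C)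
      (fun z hz => (hFd z hz).differentiableAt.differentiableWithinAt) hζd hinj (by linarith)
      (by positivity) (by positivity) (by positivity) (by linarith) ?_ ?_ ?_ hC0
    · intro z hz hzr
      have hz1 := mem_ball_zero_iff.1 hz
      have hpos : 0 < 1 - ‖z‖ := by linarith
      have hBz := hB0 z hzr.le hz1.le
      have hGz := hG0 z hz
      have hb : ‖deriv B z / B z‖ ^ 2 ≤ C₂ ^ 2 := by
        gcongr
        exact hC₂ z ⟨mem_closedBall_zero_iff.2 hz1.le, hzr.le⟩
      have hder : deriv G z / G z =
          deriv (fun z => G z * B z) z / (G z * B z) - deriv B z / B z := by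
        rw [deriv_fun_mul (hG.differentiableAt (isOpen_ball.mem_nhds hz)) (hB z)]
        field_simp
        ring
      set D := deriv (fun z => G z * B z) z / (G z * B z) with hD
      have hsq : ‖deriv G z / G z‖ ^ 2 ≤ 2 * ‖D‖ ^ 2 + 2 * C₂ ^ 2 := by
        rw [hder]
        have h1 := norm_sub_le D (deriv B z / B z)
        have h2 : ‖D - deriv B z / B z‖ ^ 2 ≤ (‖D‖ + ‖deriv B z / B z‖) ^ 2 := by gcongr
        nlinarith [sq_nonneg (‖D‖ - ‖deriv B z / B z‖)]
      have hmain : ‖F z‖ ^ 2 * ‖D‖ ^ 2 ≤ (1 + |C₃|) ^ 2 *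
          (‖deriv (fun z => G z * B z) z‖ ^ 2 * ‖G z * B z‖ ^ (-(2 + 2 * ε))) := by
        have hGp := norm_pos_iff.2 hGz
        have hBp := norm_pos_iff.2 hBz
        have hBle : ‖B z‖ ^ (2 * ε) ≤ (1 + |C₃|) ^ 2 := by
          have h1 : ‖B z‖ ≤ 1 + |C₃| := by
            linarith [hC₃ z (mem_closedBall_zero_iff.2 hz1.le), le_abs_self C₃]
          calc ‖B z‖ ^ (2 * ε) ≤ (1 + |C₃|) ^ (2 * ε) :=
                Real.rpow_le_rpow hBp.le h1 (by linarith)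
            _ ≤ (1 + |C₃|) ^ (2 : ℝ) :=
                Real.rpow_le_rpow_of_exponent_le (by linarith [abs_nonneg C₃]) (by linarith)
            _ = _ := Real.rpow_two _
        have hsplit : ‖G z‖ ^ (-(2 * ε)) * (‖G z * B z‖ ^ 2)⁻¹ =
            ‖B z‖ ^ (2 * ε) * ‖G z * B z‖ ^ (-(2 + 2 * ε)) := by
          have h0 : 0 < ‖G z * B z‖ := norm_pos_iff.2 (mul_ne_zero hGz hBz)
          rw [show -(2 + 2 * ε) = -(2 * ε) + (-2 : ℝ) by ring, Real.rpow_add h0,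
            Real.rpow_neg h0.le 2, Real.rpow_two, ← mul_assoc]
          congr 1
          rw [norm_mul, Real.mul_rpow hGp.le hBp.le, mul_left_comm, ← Real.rpow_add hBp]
          simp
        calc ‖F z‖ ^ 2 * ‖D‖ ^ 2
            = ‖deriv (fun z => G z * B z) z‖ ^ 2 *
                (‖G z‖ ^ (-(2 * ε)) * (‖G z * B z‖ ^ 2)⁻¹) := by
              rw [hFG z hz, hD, norm_div]; ring
          _ = ‖B z‖ ^ (2 * ε) *
                (‖deriv (fun z => G z * B z) z‖ ^ 2 * ‖G z * B z‖ ^ (-(2 + 2 * ε))) := by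
              rw [hsplit]; ring
          _ ≤ _ := by gcongr
      have hFz := hFle z hz
      calc ‖deriv F z‖ ^ 2 ≤ ‖F z‖ ^ 2 * (2 * ‖D‖ ^ 2 + 2 * C₂ ^ 2) :=
            (hdF z hz).trans (by gcongr)
        _ = 2 * (‖F z‖ ^ 2 * ‖D‖ ^ 2) + ‖F z‖ ^ 2 * (2 * C₂ ^ 2) := by ring
        _ ≤ 2 * ((1 + |C₃|) ^ 2 *
              (‖deriv (fun z => G z * B z) z‖ ^ 2 * ‖G z * B z‖ ^ (-(2 + 2 * ε)))) +
              (K * (1 - ‖z‖) ^ (-(1 / 2) : ℝ)) * ((C / (1 - r₀)) ^ 2 + 2 * C₂ ^ 2) := by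
            gcongr
            exact le_add_of_nonneg_left (sq_nonneg _)
        _ = _ := by ring
    · intro z hz hzr
      have hG2 : ‖deriv G z / G z‖ ≤ C / (1 - r₀) := (hC z hz).trans (by gcongr)
      calc ‖deriv F z‖ ^ 2 ≤ (K * (1 - ‖z‖) ^ (-(1 / 2) : ℝ)) * (C / (1 - r₀)) ^ 2 :=
            (hdF z hz).trans (mul_le_mul (hFle z hz) (by gcongr) (by positivity)
              ((sq_nonneg _).trans (hFle z hz)))
        _ ≤ (K * (1 - ‖z‖) ^ (-(1 / 2) : ℝ)) * ((C / (1 - r₀)) ^ 2 + 2 * C₂ ^ 2) := by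
            have hpos : 0 < 1 - ‖z‖ := by linarith [mem_ball_zero_iff.1 hz]
            gcongr
            exact le_add_of_nonneg_right (by positivity)
        _ = _ := by ring
    · intro z hz hzr
      have hz1 := mem_ball_zero_iff.1 hz
      have hBz := norm_pos_iff.2 (hB0 z hzr.le hz1.le)
      have h4 : (1 + |C₄|)⁻¹ ≤ ‖B z‖ := by
        have := hC₄ z ⟨mem_closedBall_zero_iff.2 hz1.le, hzr.le⟩
        rw [norm_inv] at this
        exact inv_le_of_inv_le₀ hBz (by linarith [le_abs_self C₄])
      have hpos : 0 < 1 - ‖z‖ := by linarith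
      calc (1 + |C₄|)⁻¹ * Real.exp (-‖g 0‖) * (1 - ‖z‖) ^ C
          = (Real.exp (-‖g 0‖) * (1 - ‖z‖) ^ C) * (1 + |C₄|)⁻¹ := by ring
        _ ≤ ‖G z‖ * ‖B z‖ := by gcongr; exact hre z hz
        _ = _ := (norm_mul _ _).symm
  obtain ⟨f, hf⟩ := hFH
  refine ⟨N, fun z => Complex.exp (g z / N), f, by exact_mod_cast hN0.ne',
    (hgd.div_const _).cexp, fun z hz => ?_, fun z hz => ?_⟩
  · rw [← Complex.exp_nat_mul, mul_div_cancel₀ _ hNc, hexp z hz]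
  · rw [hf z hz, hF, ← Complex.exp_add, add_neg_cancel, Complex.exp_zero]

/-! ### Univalent functions have non-vanishing derivative -/

theorem deriv_ne_zero_of_injOn {φ : ℂ → ℂ} {U : Set ℂ} (hU : IsOpen U)
    (hφ : DifferentiableOn ℂ φ U) (hinj : InjOn φ U) {a : ℂ} (ha : a ∈ U) : deriv φ a ≠ 0 := by
  have han : AnalyticAt ℂ (fun z => φ z - φ a) a :=
    ((hφ.analyticOnNhd hU) a ha).sub analyticAt_const
  have hne : ¬∀ᶠ z in 𝓝 a, φ z - φ a = 0 := by
    intro h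
    have h2 : ∀ᶠ z in 𝓝[≠] a, z ∈ U ∧ φ z - φ a = 0 :=
      ((hU.eventually_mem ha).and h).filter_mono nhdsWithin_le_nhds
    obtain ⟨z, ⟨hzU, hz⟩, hza⟩ := (h2.and self_mem_nhdsWithin).exists
    exact hza (hinj hzU ha (sub_eq_zero.1 hz))
  obtain ⟨n, u, hu, hua, hev⟩ := han.exists_eventuallyEq_pow_smul_nonzero_iff.2 hne
  simp only [smul_eq_mul] at hev
  have hn0 : n ≠ 0 := by
    rintro rfl
    simpa using hua (by simpa using hev.self_of_nhds.symm)
  intro hd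
  have hn1 : n ≠ 1 := by
    rintro rfl
    have h1 : HasDerivAt (fun z => (z - a) ^ 1 * u z) (u a) a := by
      have h2 : HasDerivAt (fun z => (z - a) * u z) (1 * u a + (a - a) * deriv u a) a :=
        ((hasDerivAt_id a).sub_const a).mul hu.differentiableAt.hasDerivAt
      simpa using h2
    have h2 : HasDerivAt (fun z => φ z - φ a) (deriv φ a) a :=
      ((hφ.differentiableAt (hU.mem_nhds ha)).hasDerivAt).sub_const _
    exact hua ((h1.congr_of_eventuallyEq hev).unique (hd ▸ h2))
  have hnc : (n : ℂ) ≠ 0 := by exact_mod_cast hn0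
  obtain ⟨R, hR, hball⟩ := Metric.eventually_nhds_iff_ball.1
    (((hU.eventually_mem ha).and hev).and
      (hu.eventually_analyticAt.and (hu.continuousAt.eventually_ne hua)))
  obtain ⟨g, hg, hexp⟩ := exists_differentiableOn_exp_eq hR
    (fun z hz => (hball z hz).2.1.differentiableAt.differentiableWithinAt)
    (fun z hz => (hball z hz).2.2)
  -- An `n`-th root of `φ - φ a` near `a`; it is a local homeomorphism at `a`.
  set h : ℂ → ℂ := fun z => (z - a) * Complex.exp (g z / n) with hh
  have hpow : ∀ z ∈ ball a R, h z ^ n = φ z - φ a := by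
    intro z hz
    rw [hh, mul_pow, ← Complex.exp_nat_mul, mul_div_cancel₀ _ hnc, hexp z hz, (hball z hz).1.2]
  have hhd : DifferentiableOn ℂ h (ball a R) := fun z hz =>
    (((differentiableAt_id.sub_const a).mul
      ((hg z hz).differentiableAt.div_const _).cexp)).differentiableWithinAt
  have haR := mem_ball_self hR (x := a)
  have hhan : AnalyticAt ℂ h a := hhd.analyticOnNhd isOpen_ball a haR
  have hda : deriv h a ≠ 0 := by
    have h1 : HasDerivAt h (Complex.exp (g a / n)) a := by
      refine (((hasDerivAt_id a).sub_const a).mul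
        ((hg a haR).div_const (n : ℂ)).cexp).congr_deriv ?_
      simp
    rw [h1.deriv]
    exact Complex.exp_ne_zero _
  have hmap := (hhan.hasStrictDerivAt).map_nhds_eq hda
  have himg : h '' ball a R ∈ 𝓝 (0 : ℂ) := by
    have : h a = 0 := by simp [hh]
    rw [← this, ← hmap]
    exact image_mem_map (ball_mem_nhds a hR)
  obtain ⟨t, ht, htb⟩ := Metric.mem_nhds_iff.1 himg
  have hprim := Complex.isPrimitiveRoot_exp n hn0
  set ξ := Complex.exp (2 * Real.pi * Complex.I / n)
  have hξn : ‖ξ‖ = 1 := hprim.norm'_eq_one hn0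
  have hs : ((t / 2 : ℝ) : ℂ) ≠ 0 := by exact_mod_cast (by positivity)
  have hnorm : ‖((t / 2 : ℝ) : ℂ)‖ = t / 2 := by
    rw [Complex.norm_real, Real.norm_eq_abs, abs_of_pos (by positivity)]
  obtain ⟨z₁, hz₁, e₁⟩ := htb (show ((t / 2 : ℝ) : ℂ) ∈ ball 0 t by
    rw [mem_ball_zero_iff, hnorm]; linarith)
  obtain ⟨z₂, hz₂, e₂⟩ := htb (show ((t / 2 : ℝ) : ℂ) * ξ ∈ ball 0 t by
    rw [mem_ball_zero_iff, norm_mul, hnorm, hξn]; linarith)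
  have heq : φ z₁ = φ z₂ := by
    have h1 := hpow z₁ hz₁
    have h2 := hpow z₂ hz₂
    rw [e₁] at h1
    rw [e₂, mul_pow, hprim.pow_eq_one, mul_one] at h2
    linear_combination h2 - h1
  rw [hinj (hball z₁ hz₁).1.1 (hball z₂ hz₂).1.1 heq, e₂] at e₁
  exact hprim.ne_one (by omega) (mul_left_cancel₀ hs (by rw [e₁, mul_one]))

/-! ### Functionals on the Hardy space that annihilate multiples of a function -/

theorem hardyEval_single (n : ℕ) (z : ℂ) : hardyEval (lp.single 2 n (1 : ℂ)) z = z ^ n := by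
  unfold hardyEval
  rw [tsum_eq_single n]
  · simp
  · intro m hm
    rw [lp.single_apply_ne _ _ _ hm, zero_mul]

/-- A bounded functional on `H²` is determined by its values on the monomials. -/
theorem hasSum_apply_single (L : HardySpace →L[ℂ] ℂ) (f : HardySpace) :
    HasSum (fun n => f n * L (lp.single 2 n (1 : ℂ))) (L f) := by
  refine (L.hasSum (lp.hasSum_single (by norm_num) f)).congr_fun fun n => ?_
  have : lp.single (E := fun _ : ℕ => ℂ) 2 n (f n) = f n • lp.single 2 n (1 : ℂ) := by
    rw [← lp.single_smul]; simp
  rw [this, map_smul, smul_eq_mul]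

/-- `L` annihilates all products `φ x` that lie in `H²`, with `x` in `H²`. -/
def AnnihilatesMultiples (L : HardySpace →L[ℂ] ℂ) (φ : ℂ → ℂ) : Prop :=
  ∀ x y : HardySpace, (∀ z ∈ ball (0 : ℂ) 1, hardyEval y z = φ z * hardyEval x z) → L y = 0

/-- If `E` is invertible in the sense that `1 / E` is the function of an element of `H²`, then the
multiples of `E` contain all polynomials. -/
theorem AnnihilatesMultiples.eq_zero {L : HardySpace →L[ℂ] ℂ} {E : ℂ → ℂ}
    (hL : AnnihilatesMultiples L E) (f : HardySpace)
    (hf : ∀ z ∈ ball (0 : ℂ) 1, E z * hardyEval f z = 1) : L = 0 := by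
  have h0 : ∀ n : ℕ, L (lp.single 2 n (1 : ℂ)) = 0 := by
    intro n
    have hb : IsBoundedAnalytic fun z => z ^ n := ⟨by fun_prop, 1, fun z hz => by
      rw [norm_pow]; exact pow_le_one₀ (norm_nonneg z) (mem_ball_zero_iff.1 hz).le⟩
    refine hL (toeplitz _ hb f) _ fun z hz => ?_
    rw [hardyEval_single, hardyEval_toeplitz hb f hz, mul_left_comm, hf z hz, mul_one]
  ext f
  have := hasSum_apply_single L f
  simp only [h0, mul_zero] at this
  exact this.unique hasSum_zero

theorem AnnihilatesMultiples.eq_zero_of_pow {E : ℂ → ℂ} (hE : IsBoundedAnalytic E)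
    (f : HardySpace) (hf : ∀ z ∈ ball (0 : ℂ) 1, E z * hardyEval f z = 1) (N : ℕ)
    {L : HardySpace →L[ℂ] ℂ} (hL : AnnihilatesMultiples L fun z => E z ^ (N + 1)) : L = 0 := by
  induction N with
  | zero => exact AnnihilatesMultiples.eq_zero (by simpa using hL) f hf
  | succ N ih =>
    refine ih fun x y hxy => ?_
    have hb : IsBoundedAnalytic fun z => E z ^ (N + 1) := by
      obtain ⟨C, hC⟩ := hE.bounded
      refine ⟨hE.differentiableOn.pow _, C ^ (N + 1), fun z hz => ?_⟩
      rw [norm_pow]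
      have := hC z hz
      gcongr
    -- The functional `x ↦ L (E ^ (N + 1) x)` annihilates the multiples of `E`.
    have hcomp : L ∘L toeplitz _ hb = 0 := by
      refine AnnihilatesMultiples.eq_zero (E := E) (fun x y hxy => ?_) f hf
      refine hL x (toeplitz _ hb y) fun z hz => ?_
      rw [hardyEval_toeplitz hb y hz, hxy z hz]
      ring
    have hy : y = toeplitz _ hb x := hardyEval_injOn fun z hz => by
      rw [hardyEval_toeplitz hb x hz, hxy z hz]
    rw [hy]
    exact congrArg (fun T : HardySpace →L[ℂ] ℂ => T x) hcomp

/-- The multiples of a bounded zero-free `G` are dense in `H²`, when `G B` is univalent for some `B`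
without zeros near the unit circle. -/
theorem AnnihilatesMultiples.eq_zero_of_injOn_mul {G B : ℂ → ℂ} {r₀ : ℝ}
    (hG : IsBoundedAnalytic G) (hG0 : ∀ z ∈ ball (0 : ℂ) 1, G z ≠ 0)
    (hB : Differentiable ℂ B) (hr : r₀ < 1) (hB0 : ∀ z, r₀ ≤ ‖z‖ → ‖z‖ ≤ 1 → B z ≠ 0)
    (hinj : InjOn (fun z => G z * B z) (ball 0 1)) {L : HardySpace →L[ℂ] ℂ}
    (hL : AnnihilatesMultiples L G) : L = 0 := by
  obtain ⟨N, E, f, hN, hEd, hEN, hEf⟩ :=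
    exists_hardyEval_rpow_neg hG.differentiableOn hG0 hB hr hB0 hinj
  have hE : IsBoundedAnalytic E := by
    obtain ⟨C, hC⟩ := hG.bounded
    refine ⟨hEd, 1 + |C|, fun z hz => ?_⟩
    by_contra! hlt
    have h1 : 1 ≤ ‖E z‖ := by linarith [abs_nonneg C]
    have h2 := le_self_pow₀ h1 hN
    rw [← norm_pow, hEN z hz] at h2
    linarith [hC z hz, le_abs_self C]
  obtain ⟨k, rfl⟩ := Nat.exists_eq_succ_of_ne_zero hN
  refine AnnihilatesMultiples.eq_zero_of_pow hE f hEf k fun x y hxy => hL x y fun z hz => ?_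
  rw [hxy z hz, ← hEN z hz]

/-! ### Eigenvectors of the adjoint of a Toeplitz operator with univalent symbol -/

/-- A functional `L` with `L (φ x) = c L x`, `φ` univalent, is zero if `c` is not a value of `φ`. -/
theorem eq_zero_of_apply_toeplitz_eq_mul {φ : ℂ → ℂ} (hφ : IsBoundedAnalytic φ)
    (hinj : InjOn φ (ball 0 1)) {L : HardySpace →L[ℂ] ℂ} {c : ℂ}
    (hL : ∀ x, L (toeplitz φ hφ x) = c * L x) (hc : ∀ a ∈ ball (0 : ℂ) 1, φ a ≠ c) : L = 0 := by
  have hG : IsBoundedAnalytic fun z => φ z - c := by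
    obtain ⟨C, hC⟩ := hφ.bounded
    exact ⟨hφ.differentiableOn.sub_const c, C + ‖c‖, fun z hz =>
      (norm_sub_le _ _).trans (by gcongr; exact hC z hz)⟩
  refine AnnihilatesMultiples.eq_zero_of_injOn_mul (B := fun _ => 1) (r₀ := 0) hG
    (fun z hz => sub_ne_zero.2 (hc z hz)) (differentiable_const _) one_pos
    (fun _ _ _ => one_ne_zero) (fun z hz w hw hzw => hinj hz hw (by simpa using hzw)) ?_
  intro x y hxy
  have hy : y = toeplitz φ hφ x - c • x := hardyEval_injOn fun z hz => by
    rw [hxy z hz, sub_eq_add_neg (toeplitz φ hφ x), ← neg_smul, hardyEval_add _ _ hz,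
      hardyEval_smul _ _ hz, hardyEval_toeplitz hφ x hz]
    ring
  rw [hy, map_sub, map_smul, hL, smul_eq_mul, sub_self]

/-- The difference quotient of a bounded analytic function at a point of the disc is bounded. -/
theorem IsBoundedAnalytic.dslope {φ : ℂ → ℂ} (hφ : IsBoundedAnalytic φ) {a : ℂ}
    (ha : a ∈ ball (0 : ℂ) 1) : IsBoundedAnalytic (dslope φ a) := by
  have hd : DifferentiableOn ℂ (_root_.dslope φ a) (ball 0 1) :=
    (Complex.differentiableOn_dslope (isOpen_ball.mem_nhds ha)).2 hφ.differentiableOn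
  obtain ⟨M, hM⟩ := hφ.bounded
  have ha1 := mem_ball_zero_iff.1 ha
  obtain ⟨C, hC⟩ := (isCompact_closedBall (0 : ℂ) ((1 + ‖a‖) / 2)).exists_bound_of_continuousOn
    (hd.continuousOn.mono (closedBall_subset_ball (by linarith)))
  have hM0 : 0 ≤ M := (norm_nonneg _).trans (hM a ha)
  refine ⟨hd, |C| + (M + M) / ((1 - ‖a‖) / 2), fun z hz => ?_⟩
  have hδ : 0 < (1 - ‖a‖) / 2 := by linarith
  rcases le_or_gt ‖z‖ ((1 + ‖a‖) / 2) with hle | hgt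
  · have h1 := (hC z (mem_closedBall_zero_iff.2 hle)).trans (le_abs_self C)
    have : 0 ≤ (M + M) / ((1 - ‖a‖) / 2) := by positivity
    linarith
  · have hza : z ≠ a := by rintro rfl; linarith
    have h1 : (1 - ‖a‖) / 2 ≤ ‖z - a‖ := by linarith [norm_sub_norm_le z a]
    rw [dslope_of_ne _ hza, slope_def_field, norm_div]
    have h2 : ‖φ z - φ a‖ / ‖z - a‖ ≤ (M + M) / ((1 - ‖a‖) / 2) :=
      div_le_div₀ (by positivity) ((norm_sub_le _ _).trans (add_le_add (hM z hz) (hM a ha))) hδ h1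
    linarith [abs_nonneg C]

/-- A functional `L` with `L (φ x) = φ a L x`, `φ` univalent, is a multiple of the evaluation
at `a`. -/
theorem apply_eq_mul_hardyEval_of_apply_toeplitz_eq_mul {φ : ℂ → ℂ} (hφ : IsBoundedAnalytic φ)
    (hinj : InjOn φ (ball 0 1)) {L : HardySpace →L[ℂ] ℂ} {a : ℂ} (ha : a ∈ ball (0 : ℂ) 1)
    (hL : ∀ x, L (toeplitz φ hφ x) = φ a * L x) (f : HardySpace) :
    L f = L (lp.single 2 0 (1 : ℂ)) * hardyEval f a := by
  have ha1 := mem_ball_zero_iff.1 ha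
  have hB : IsBoundedAnalytic fun z => z - a := ⟨by fun_prop, 1 + 1, fun z hz =>
    (norm_sub_le _ _).trans (add_le_add (mem_ball_zero_iff.1 hz).le ha1.le)⟩
  have hprod : ∀ z, _root_.dslope φ a z * (z - a) = φ z - φ a := fun z => by
    rw [mul_comm, ← smul_eq_mul, sub_smul_dslope]
  have hcomp : L ∘L toeplitz _ hB = 0 := by
    refine AnnihilatesMultiples.eq_zero_of_injOn_mul (G := _root_.dslope φ a)
      (B := fun z => z - a) (r₀ := (1 + ‖a‖) / 2) (hφ.dslope ha) ?_ (by fun_prop) (by linarith)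
      ?_ ?_ ?_
    · intro z hz
      by_cases hza : z = a
      · rw [hza, dslope_same]
        exact deriv_ne_zero_of_injOn isOpen_ball hφ.differentiableOn hinj ha
      · intro h0
        have := hprod z
        rw [h0, zero_mul] at this
        exact hza (hinj hz ha (sub_eq_zero.1 this.symm))
    · intro z hz _ h0
      rw [sub_eq_zero.1 h0] at hz
      linarith
    · intro z hz w hw hzw
      simp only [hprod] at hzw
      exact hinj hz hw (sub_left_injective hzw)
    · intro x y hxy
      have hy : toeplitz _ hB y = toeplitz φ hφ x - φ a • x := hardyEval_injOn fun z hz => by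
        rw [hardyEval_toeplitz hB y hz, hxy z hz, sub_eq_add_neg (toeplitz φ hφ x), ← neg_smul,
          hardyEval_add _ _ hz, hardyEval_smul _ _ hz, hardyEval_toeplitz hφ x hz]
        linear_combination hardyEval x z * hprod z
      rw [ContinuousLinearMap.comp_apply, hy, map_sub, map_smul, hL, smul_eq_mul, sub_self]
  have hmono : ∀ n : ℕ, L (lp.single 2 n (1 : ℂ)) = L (lp.single 2 0 (1 : ℂ)) * a ^ n := by
    intro n
    induction n with
    | zero => simp
    | succ n ih =>
      have h1 : lp.single 2 (n + 1) (1 : ℂ) =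
          toeplitz _ hB (lp.single 2 n (1 : ℂ)) + a • lp.single 2 n (1 : ℂ) :=
        hardyEval_injOn fun z hz => by
          rw [hardyEval_add _ _ hz, hardyEval_smul _ _ hz, hardyEval_toeplitz hB _ hz,
            hardyEval_single, hardyEval_single]
          ring
      have h2 : L (toeplitz _ hB (lp.single 2 n (1 : ℂ))) = 0 :=
        congrArg (fun T : HardySpace →L[ℂ] ℂ => T (lp.single 2 n (1 : ℂ))) hcomp
      rw [h1, map_add, h2, zero_add, map_smul, ih, smul_eq_mul]
      ring
  refine (hasSum_apply_single L f).unique ?_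
  refine ((hasSum_hardyEval f ha1).mul_left (L (lp.single 2 0 (1 : ℂ)))).congr_fun fun n => ?_
  rw [hmono]
  ring

/-- The evaluation at a point of the disc as a bounded functional on `H²`. -/
noncomputable def hardyEvalCLM {z : ℂ} (hz : z ∈ ball (0 : ℂ) 1) : HardySpace →L[ℂ] ℂ :=
  LinearMap.mkContinuousOfExistsBound
    { toFun := fun f => hardyEval f z
      map_add' := fun f g => hardyEval_add f g hz
      map_smul' := fun c f => hardyEval_smul c f hz }
    (by
      have hz1 := mem_ball_zero_iff.1 hz
      have hgeo := hasSum_geometric_of_lt_one (norm_nonneg z) hz1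
      refine ⟨(1 - ‖z‖)⁻¹, fun f => ?_⟩
      change ‖hardyEval f z‖ ≤ _
      rw [mul_comm]
      refine tsum_of_norm_bounded (hgeo.mul_left ‖f‖) fun n => ?_
      rw [norm_mul, norm_pow]
      gcongr
      exact hardy_norm_coeff_le f n)

/-! ### Quotients of holomorphic functions -/

/-- If `u = τ h` on the disc, where `‖τ‖ < 1` and `h` is not identically zero, then the holomorphic
function `u / h` extends to a holomorphic self-map of the disc. -/
theorem exists_mapsTo_ball_eq_of_mul_eq {h u τ : ℂ → ℂ} (hh : DifferentiableOn ℂ h (ball 0 1))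
    (hu : DifferentiableOn ℂ u (ball 0 1)) (hne : ∃ z ∈ ball (0 : ℂ) 1, h z ≠ 0)
    (hτ : ∀ z ∈ ball (0 : ℂ) 1, ‖τ z‖ < 1) (heq : ∀ z ∈ ball (0 : ℂ) 1, u z = h z * τ z) :
    ∃ ω : ℂ → ℂ, DifferentiableOn ℂ ω (ball 0 1) ∧ MapsTo ω (ball 0 1) (ball 0 1) ∧
      ∀ z ∈ ball (0 : ℂ) 1, h z ≠ 0 → ω z = τ z := by
  classical
  have hquot : ∀ z ∈ ball (0 : ℂ) 1, h z ≠ 0 → u z / h z = τ z := fun z hz h0 => by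
    rw [heq z hz, mul_div_cancel_left₀ _ h0]
  have hev : ∀ c ∈ ball (0 : ℂ) 1, ∀ᶠ z in 𝓝[≠] c, z ∈ ball (0 : ℂ) 1 ∧ h z ≠ 0 := by
    intro c hc
    have han := hh.analyticOnNhd isOpen_ball
    refine ((isOpen_ball.eventually_mem hc).filter_mono nhdsWithin_le_nhds).and ?_
    refine (han c hc).eventually_eq_zero_or_eventually_ne_zero.resolve_left fun h0 => ?_
    obtain ⟨z, hz, hz0⟩ := hne
    exact hz0 (han.eqOn_zero_of_preconnected_of_eventuallyEq_zero
      (convex_ball 0 1).isPreconnected hc h0 hz)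
  set ω : ℂ → ℂ := fun z =>
    if h z = 0 then limUnder (𝓝[≠] z) (fun w => u w / h w) else u z / h z with hω
  have hωτ : ∀ z ∈ ball (0 : ℂ) 1, h z ≠ 0 → ω z = τ z := fun z hz h0 => by
    simp only [hω, if_neg h0]
    exact hquot z hz h0
  have hωd : DifferentiableOn ℂ ω (ball 0 1) := by
    intro c hc
    refine DifferentiableAt.differentiableWithinAt ?_
    have hhc := hh.differentiableAt (isOpen_ball.mem_nhds hc)
    have huc := hu.differentiableAt (isOpen_ball.mem_nhds hc)
    by_cases h0 : h c = 0
    · obtain ⟨R, hR, hball⟩ := Metric.eventually_nhds_iff_ball.1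
        (eventually_nhdsWithin_iff.1 (hev c hc))
      have hin : ∀ z ∈ ball c R \ {c}, z ∈ ball (0 : ℂ) 1 ∧ h z ≠ 0 := fun z hz =>
        hball z hz.1 hz.2
      have hupd := Complex.differentiableOn_update_limUnder_of_bddAbove
        (f := fun w => u w / h w) (ball_mem_nhds c hR)
        ((hu.mono fun z hz => (hin z hz).1).div (hh.mono fun z hz => (hin z hz).1)
          fun z hz => (hin z hz).2)
        ⟨1, by
          rintro _ ⟨z, hz, rfl⟩
          simp only [Function.comp_apply, hquot z (hin z hz).1 (hin z hz).2]
          exact (hτ z (hin z hz).1).le⟩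
      refine (hupd.differentiableAt (ball_mem_nhds c hR)).congr_of_eventuallyEq ?_
      filter_upwards [ball_mem_nhds c hR] with z hz
      by_cases hzc : z = c
      · subst hzc
        simp [hω, h0]
      · rw [Function.update_of_ne hzc]
        simp [hω, (hin z ⟨hz, hzc⟩).2]
    · refine (huc.div hhc h0).congr_of_eventuallyEq ?_
      filter_upwards [hhc.continuousAt.eventually_ne h0] with z hz
      simp [hω, hz]
  have hle : ∀ z ∈ ball (0 : ℂ) 1, ‖ω z‖ ≤ 1 := by
    intro c hc
    refine le_of_tendsto ((hωd.differentiableAt (isOpen_ball.mem_nhds hc)).continuousAt.norm.tendsto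
      |>.mono_left (nhdsWithin_le_nhds (s := {c}ᶜ))) ?_
    filter_upwards [hev c hc] with z hz
    rw [hωτ z hz.1 hz.2]
    exact (hτ z hz.1).le
  refine ⟨ω, hωd, fun c hc => ?_, hωτ⟩
  rw [mem_ball_zero_iff]
  by_contra! hge
  have hconst := Complex.eqOn_of_isPreconnected_of_isMaxOn_norm (convex_ball 0 1).isPreconnected
    isOpen_ball hωd hc (fun z hz => (hle z hz).trans hge)
  obtain ⟨z, hz, hz0⟩ := hne
  have h1 := hconst hz
  rw [Function.const_apply, hωτ z hz hz0] at h1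
  rw [← h1] at hge
  exact (hτ z hz).not_ge hge

/-! ### Intertwining operators -/

theorem mainTheorem10 (φ ψ : ℂ → ℂ) (hφ : IsBoundedAnalytic φ) (hψ : IsBoundedAnalytic ψ)
    (hφ_univalent : Set.InjOn φ (Metric.ball 0 1))
    (X : HardySpace →L[ℂ] HardySpace)
    (hX : Intertwines X (toeplitz φ hφ) (toeplitz ψ hψ)) :
    ∃ (ω : ℂ → ℂ) (h : HardySpace), IsWeightedCompositionOperator X ω h := by
  obtain ⟨hcomm, hX0⟩ := hX
  set h : HardySpace := X (lp.single 2 0 (1 : ℂ)) with hh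
  -- At each point `z`, either `ψ z` is a value `φ a`, or `X f` vanishes at `z` for all `f`; in the
  -- latter case `h z = 0`, and any point of the disc serves as `a`.
  have hpt : ∀ z ∈ ball (0 : ℂ) 1, ∃ a ∈ ball (0 : ℂ) 1,
      ∀ f, hardyEval (X f) z = hardyEval h z * hardyEval f a := by
    intro z hz
    set L : HardySpace →L[ℂ] ℂ := hardyEvalCLM hz ∘L X
    have hLX : ∀ f, L f = hardyEval (X f) z := fun f => rfl
    have hL : ∀ x, L (toeplitz φ hφ x) = ψ z * L x := by
      intro x
      have := congrArg (fun T : HardySpace →L[ℂ] HardySpace => T x) hcomm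
      simp only [ContinuousLinearMap.comp_apply] at this
      rw [hLX, this, hardyEval_toeplitz hψ _ hz, hLX]
    by_cases hc : ∃ a ∈ ball (0 : ℂ) 1, φ a = ψ z
    · obtain ⟨a, ha, hac⟩ := hc
      refine ⟨a, ha, fun f => ?_⟩
      rw [← hac] at hL
      exact apply_eq_mul_hardyEval_of_apply_toeplitz_eq_mul hφ hφ_univalent ha hL f
    · push Not at hc
      have hL0 := eq_zero_of_apply_toeplitz_eq_mul hφ hφ_univalent hL hc
      have h0 : ∀ f, hardyEval (X f) z = 0 := fun f => by rw [← hLX, hL0]; rfl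
      exact ⟨0, by simp, fun f => by rw [h0, hh, h0, zero_mul]⟩
  choose! τ hτ hXτ using hpt
  have hne : ∃ z ∈ ball (0 : ℂ) 1, hardyEval h z ≠ 0 := by
    by_contra! h0
    refine hX0 (ContinuousLinearMap.ext fun f => hardyEval_injOn fun z hz => ?_)
    rw [hXτ z hz f, h0 z hz, zero_mul]
    simp [hardyEval]
  obtain ⟨ω, hωd, hωm, hωτ⟩ := exists_mapsTo_ball_eq_of_mul_eq (differentiableOn_hardyEval h)
    (differentiableOn_hardyEval (X (lp.single 2 1 (1 : ℂ)))) hne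
    (fun z hz => mem_ball_zero_iff.1 (hτ z hz))
    (fun z hz => by rw [hXτ z hz, hardyEval_single, pow_one])
  refine ⟨ω, h, hωd, hωm, fun f z hz => ?_⟩
  rw [hXτ z hz f]
  by_cases h0 : hardyEval h z = 0
  · rw [h0, zero_mul, zero_mul]
  · rw [hωτ z hz h0]
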